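/- For each integer $n\ge 1$ let $J_1,J_2,J_3:\mathbb C^n\to\mathbb C^n$ be the self-adjoint generators of an $n$-dimensional unitary irreducible representation of $SU(2)$, normalised by $[J_1,J_2]=iJ_3$, $[J_2,J_3]=iJ_1$, $[J_3,J_1]=iJ_2$. Their spectrum is $\sigma_n=\{j,j-1,\dots,-j\}$, where $2j+1=n$. Fix $0<\alpha\le\frac12$, and for each $n\ge 1$ let $\alpha_n$ be a real number such that the interval $(0,\alpha_n)$ contains exactly $\lfloor\alpha n\rfloor$ elements of $\sigma_n$. Let $P_{3,\alpha,n}=\mathbb 1_{(0,\alpha_n)}(J_3)$ and $P_{1,n}=\mathbb 1_{(0,\infty)}(J_1)$ be the corresponding spectral (orthogonal) projections. For $0\le s<t\le 1$ let $N_n(s,t)$ be the number of eigenvalues, counted with multiplicity, of $$R_n=P_{3,\alpha,n}\,P_{1,n}\,P_{3,\alpha,n}\in\operatorname{End}\bigl(\operatorname{Im}(P_{3,\alpha,n})\bigr)$$ lying in the closed interval $[s,t]$. Then for every $0<t<\frac12$, $$\lim_{n\to\infty}\frac{1}{\alpha n}N_n(0,t)=\lim_{n\to\infty}\frac{1}{\alpha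 n}N_n(1-t,1)=\frac12,$$ and $$N_n(t,1-t)=\mathcal O(\log n)\qquad (n\to\infty).$$ -/

import Mathlib

open Filter Topology Asymptotics

/-- `J₁, J₂, J₃` are the (self-adjoint) generators of a unitary irreducible representation of
`SU(2)` on `ℂⁿ`, normalised by `[J₁, J₂] = i J₃`, `[J₂, J₃] = i J₁`, `[J₃, J₁] = i J₂`. -/
structure IsSpinTriple {n : ℕ}
    (J₁ J₂ J₃ : Module.End ℂ (EuclideanSpace ℂ (Fin n))) : Prop where
  isSymmetric_one : J₁.IsSymmetric
  isSymmetric_two : J₂.IsSymmetric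
  isSymmetric_three : J₃.IsSymmetric
  comm_one_two : J₁ * J₂ - J₂ * J₁ = Complex.I • J₃
  comm_two_three : J₂ * J₃ - J₃ * J₂ = Complex.I • J₁
  comm_three_one : J₃ * J₁ - J₁ * J₃ = Complex.I • J₂
  /-- The only subspaces invariant under all three operators are the trivial ones. -/
  irreducible : ∀ W : Submodule ℂ (EuclideanSpace ℂ (Fin n)),
    (∀ v ∈ W, J₁ v ∈ W) → (∀ v ∈ W, J₂ v ∈ W) → (∀ v ∈ W, J₃ v ∈ W) → W = ⊥ ∨ W = ⊤

/-- The set `σ_n = {j, j - 1, …, -j}`, where `2 j + 1 = n`. -/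
def spinSpectrum (n : ℕ) : Set ℝ :=
  Set.range fun k : Fin n => ((n : ℝ) - 1) / 2 - (k : ℝ)

/-- The spectral projection `𝟙_S(A)` of a self-adjoint operator `A` on `ℂⁿ`: the orthogonal
projection onto the sum of the eigenspaces of `A` with eigenvalue in `S`. -/
noncomputable def spectralProjection {n : ℕ} (A : Module.End ℂ (EuclideanSpace ℂ (Fin n)))
    (S : Set ℝ) : Module.End ℂ (EuclideanSpace ℂ (Fin n)) :=
  ((⨆ x ∈ S, Module.End.eigenspace A (x : ℂ)).starProjection :
    EuclideanSpace ℂ (Fin n) →L[ℂ] EuclideanSpace ℂ (Fin n))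

/-- The operator `P Q P`, viewed as an endomorphism of the range of `P`. -/
def compression {n : ℕ} (P Q : Module.End ℂ (EuclideanSpace ℂ (Fin n))) :
    Module.End ℂ (LinearMap.range P) :=
  (P * Q * P).restrict fun v _ => LinearMap.mem_range_self P ((Q * P) v)

open Classical in
/-- The number of eigenvalues of `T` lying in the real interval `[s, t]`, counted with (algebraic)
multiplicity. -/
noncomputable def eigenvalueCount {V : Type*} [AddCommGroup V] [Module ℂ V]
    [FiniteDimensional ℂ V] (T : Module.End ℂ V) (s t : ℝ) : ℕ :=
  T.charpoly.roots.countP fun z => ∃ x ∈ Set.Icc s t, z = (x : ℂ)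

open scoped InnerProductSpace

/-!
The eigenvalues of `R_n` lie in `[0, 1]`, so `tr R_n (1 - R_n)` controls how many of them are away
from `0` and `1`. In the weight basis `e_k` of `J₃` this trace is the sum of the squared matrix
elements `⟪e_l, P₁ e_k⟫` of `P₁ = 𝟙_{(0,∞)}(J₁)` with `k` inside and `l` outside an interval of
indices. In the weight basis of `J₁` the operator `J₃` is tridiagonal, so `[J₃, P₁]` has rank at
most two and involves only the two eigenvectors of `J₁` on either side of the cut at `0`. Their
components in the bulk of the basis `e_k` are `O(n ^ (-1 / 2))`, so that
`⟪e_l, P₁ e_k⟫ = O(1 / |k - l|)` near the ends of the interval, and the sum is `O(log n)`. The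
rotation by `π` about the third axis fixes the lines `ℂ e_k` and exchanges `𝟙_{(0,∞)}(J₁)` with
`𝟙_{(-∞,0)}(J₁)`; this makes `tr R_n` half of the dimension, up to a bounded error.
-/

section EigenvalueCount

lemma abs_indicator_Icc_one_sub_le {x t : ℝ} (hx : x ∈ Set.Icc 0 1) (ht₀ : 0 < t)
    (ht₁ : t ≤ 1 / 2) :
    |(Set.Icc (1 - t) 1).indicator 1 x - x| ≤ x * (1 - x) / t := by
  obtain ⟨hx₀, hx₁⟩ := hx
  rw [le_div_iff₀ ht₀]
  by_cases h : 1 - t ≤ x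
  · rw [Set.indicator_of_mem (Set.mem_Icc.2 ⟨h, hx₁⟩), Pi.one_apply, abs_of_nonneg (by linarith)]
    nlinarith
  · rw [Set.indicator_of_notMem fun h' => h h'.1, zero_sub, abs_neg, abs_of_nonneg hx₀]
    nlinarith

lemma abs_indicator_Icc_zero_sub_le {x t : ℝ} (hx : x ∈ Set.Icc 0 1) (ht₀ : 0 < t)
    (ht₁ : t ≤ 1 / 2) :
    |(Set.Icc 0 t).indicator 1 x - (1 - x)| ≤ x * (1 - x) / t := by
  have h := abs_indicator_Icc_one_sub_le (x := 1 - x) ⟨by linarith [hx.2], by linarith [hx.1]⟩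
    ht₀ ht₁
  have hmem : 1 - x ∈ Set.Icc (1 - t) 1 ↔ x ∈ Set.Icc 0 t := by
    constructor <;> rintro ⟨h₀, h₁⟩ <;> constructor <;> linarith
  rw [show (Set.Icc 0 t).indicator (1 : ℝ → ℝ) x = (Set.Icc (1 - t) 1).indicator 1 (1 - x) by
    simp only [Set.indicator_apply, hmem, Pi.one_apply]]
  rwa [sub_sub_cancel, mul_comm] at h

lemma indicator_Icc_le_two_mul {x t : ℝ} (hx : x ∈ Set.Icc 0 1) (ht₀ : 0 < t)
    (ht₁ : t ≤ 1 / 2) :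
    (Set.Icc t (1 - t)).indicator 1 x ≤ 2 * (x * (1 - x)) / t := by
  obtain ⟨hx₀, hx₁⟩ := hx
  rw [le_div_iff₀ ht₀]
  by_cases h : x ∈ Set.Icc t (1 - t)
  · rw [Set.indicator_of_mem h, Pi.one_apply]
    nlinarith [h.1, h.2]
  · rw [Set.indicator_of_notMem h]
    nlinarith

variable {V : Type*} [NormedAddCommGroup V] [InnerProductSpace ℂ V] [FiniteDimensional ℂ V]
  {T : Module.End ℂ V}

lemma eigenvalueCount_eq_sum_indicator (hT : T.IsSymmetric) {d : ℕ}
    (hd : Module.finrank ℂ V = d) (s t : ℝ) :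
    (eigenvalueCount T s t : ℝ) =
      ∑ i, (Set.Icc s t).indicator 1 (hT.eigenvalues hd i) := by
  classical
  have hiff (x : ℝ) : (∃ y ∈ Set.Icc s t, (x : ℂ) = y) ↔ x ∈ Set.Icc s t := by
    simp only [Complex.ofReal_inj, exists_eq_right']
  rw [eigenvalueCount, hT.roots_charpoly_eq_eigenvalues hd, Multiset.countP_map]
  simp only [Set.indicator_apply, Pi.one_apply, Finset.sum_boole]
  rw [← Finset.filter_val, Finset.card_val]
  simp only [Function.comp_apply, RCLike.ofReal_eq_complex_ofReal, hiff]

lemma re_trace_mul_one_sub_eq_sum_eigenvalues (hT : T.IsSymmetric) {d : ℕ}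
    (hd : Module.finrank ℂ V = d) :
    (LinearMap.trace ℂ V (T * (1 - T))).re =
      ∑ i, hT.eigenvalues hd i * (1 - hT.eigenvalues hd i) := by
  rw [LinearMap.trace_eq_sum_inner _ (hT.eigenvectorBasis hd), Complex.re_sum]
  refine Finset.sum_congr rfl fun i _ => ?_
  rw [Module.End.mul_apply, ← hT, LinearMap.sub_apply, Module.End.one_apply,
    hT.apply_eigenvectorBasis, inner_sub_right, inner_smul_left, inner_smul_right,
    inner_smul_left, inner_self_eq_norm_sq_to_K, OrthonormalBasis.norm_eq_one]
  simp [mul_sub]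

lemma eigenvalues_mem_Icc (hT : T.IsPositive) (hT' : (1 - T).IsPositive) {d : ℕ}
    (hd : Module.finrank ℂ V = d) (i : Fin d) :
    hT.isSymmetric.eigenvalues hd i ∈ Set.Icc 0 1 := by
  refine ⟨hT.nonneg_eigenvalues hd i, ?_⟩
  have h := hT'.re_inner_nonneg_left (hT.isSymmetric.eigenvectorBasis hd i)
  rw [LinearMap.sub_apply, Module.End.one_apply, hT.isSymmetric.apply_eigenvectorBasis,
    inner_sub_left, inner_smul_left, inner_self_eq_norm_sq_to_K,
    OrthonormalBasis.norm_eq_one] at h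
  simpa using h

variable {t : ℝ}

theorem abs_eigenvalueCount_top_sub_trace_le (hT : T.IsPositive) (hT' : (1 - T).IsPositive)
    (ht₀ : 0 < t) (ht₁ : t ≤ 1 / 2) :
    |eigenvalueCount T (1 - t) 1 - (LinearMap.trace ℂ V T).re| ≤
      (LinearMap.trace ℂ V (T * (1 - T))).re / t := by
  rw [eigenvalueCount_eq_sum_indicator hT.isSymmetric rfl,
    re_trace_mul_one_sub_eq_sum_eigenvalues hT.isSymmetric rfl,
    show (LinearMap.trace ℂ V T).re = _ from hT.isSymmetric.re_trace_eq_sum_eigenvalues rfl,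
    ← Finset.sum_sub_distrib, Finset.sum_div]
  exact (Finset.abs_sum_le_sum_abs _ _).trans <| Finset.sum_le_sum fun i _ =>
    abs_indicator_Icc_one_sub_le (eigenvalues_mem_Icc hT hT' rfl i) ht₀ ht₁

theorem abs_eigenvalueCount_bottom_sub_trace_le (hT : T.IsPositive) (hT' : (1 - T).IsPositive)
    (ht₀ : 0 < t) (ht₁ : t ≤ 1 / 2) :
    |eigenvalueCount T 0 t - (Module.finrank ℂ V - (LinearMap.trace ℂ V T).re)| ≤
      (LinearMap.trace ℂ V (T * (1 - T))).re / t := by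
  have hfinrank : (Module.finrank ℂ V : ℝ) = ∑ _i : Fin (Module.finrank ℂ V), (1 : ℝ) := by simp
  rw [eigenvalueCount_eq_sum_indicator hT.isSymmetric rfl,
    re_trace_mul_one_sub_eq_sum_eigenvalues hT.isSymmetric rfl,
    show (LinearMap.trace ℂ V T).re = _ from hT.isSymmetric.re_trace_eq_sum_eigenvalues rfl,
    hfinrank, ← Finset.sum_sub_distrib, ← Finset.sum_sub_distrib, Finset.sum_div]
  exact (Finset.abs_sum_le_sum_abs _ _).trans <| Finset.sum_le_sum fun i _ =>
    abs_indicator_Icc_zero_sub_le (eigenvalues_mem_Icc hT hT' rfl i) ht₀ ht₁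

theorem eigenvalueCount_middle_le_trace (hT : T.IsPositive) (hT' : (1 - T).IsPositive)
    (ht₀ : 0 < t) (ht₁ : t ≤ 1 / 2) :
    (eigenvalueCount T t (1 - t) : ℝ) ≤ 2 * (LinearMap.trace ℂ V (T * (1 - T))).re / t := by
  rw [eigenvalueCount_eq_sum_indicator hT.isSymmetric rfl,
    re_trace_mul_one_sub_eq_sum_eigenvalues hT.isSymmetric rfl, Finset.mul_sum, Finset.sum_div]
  exact Finset.sum_le_sum fun i _ =>
    indicator_Icc_le_two_mul (eigenvalues_mem_Icc hT hT' rfl i) ht₀ ht₁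

end EigenvalueCount

section SymmetricProjection

variable {E : Type*} [NormedAddCommGroup E] [InnerProductSpace ℂ E] {Q : Module.End ℂ E}

lemma inner_apply_self_eq_sq_norm (hQ : Q.IsSymmetricProjection) (v : E) :
    ⟪v, Q v⟫_ℂ = (‖Q v‖ : ℂ) ^ 2 := by
  rw [← RCLike.ofReal_eq_complex_ofReal, ← inner_self_eq_norm_sq_to_K, hQ.isSymmetric,
    ← Module.End.mul_apply, hQ.isIdempotentElem.eq]

lemma re_inner_apply_self_eq_sq_norm (hQ : Q.IsSymmetricProjection) (v : E) :
    (⟪v, Q v⟫_ℂ).re = ‖Q v‖ ^ 2 := by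
  rw [inner_apply_self_eq_sq_norm hQ]
  norm_cast

lemma re_trace_eq_sum_sq_norm {ι : Type*} [Fintype ι] (hQ : Q.IsSymmetricProjection)
    (b : OrthonormalBasis ι ℂ E) : (LinearMap.trace ℂ _ Q).re = ∑ k, ‖Q (b k)‖ ^ 2 := by
  rw [LinearMap.trace_eq_sum_inner _ b, Complex.re_sum]
  exact Finset.sum_congr rfl fun k _ => re_inner_apply_self_eq_sq_norm hQ (b k)

end SymmetricProjection

section Compression

variable {n : ℕ} {P Q : Module.End ℂ (EuclideanSpace ℂ (Fin n))}

lemma coe_compression_apply (hP : IsIdempotentElem P) (x : LinearMap.range P) :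
    (compression P Q x : EuclideanSpace ℂ (Fin n)) = P (Q x) :=
  congrArg (P ∘ Q) ((LinearMap.IsIdempotentElem.mem_range_iff hP).1 x.2)

lemma compression_one (hP : IsIdempotentElem P) : compression P 1 = 1 :=
  LinearMap.ext fun x => Subtype.ext <|
    (coe_compression_apply hP x).trans ((LinearMap.IsIdempotentElem.mem_range_iff hP).1 x.2)

lemma one_sub_compression (hP : IsIdempotentElem P) :
    1 - compression P Q = compression P (1 - Q) := by
  rw [← compression_one hP]
  refine LinearMap.ext fun x => Subtype.ext ?_
  simp only [LinearMap.sub_apply, AddSubgroupClass.coe_sub, coe_compression_apply hP, map_sub]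

lemma compression_mul_compression (hP : IsIdempotentElem P)
    (Q' : Module.End ℂ (EuclideanSpace ℂ (Fin n))) :
    compression P Q * compression P Q' = compression P (Q * P * Q') :=
  LinearMap.ext fun x => Subtype.ext <| by
    simp only [Module.End.mul_apply, coe_compression_apply hP]

lemma isPositive_compression (hP : P.IsSymmetricProjection) (hQ : Q.IsPositive) :
    LinearMap.IsPositive (𝕜 := ℂ) (E := LinearMap.range P) (compression P Q) := by
  have hinner (x y : LinearMap.range P) :
      ⟪(P (Q x) : EuclideanSpace ℂ (Fin n)), y⟫_ℂ = ⟪Q x, (y : EuclideanSpace ℂ (Fin n))⟫_ℂ := by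
    rw [hP.isSymmetric,
      (LinearMap.IsIdempotentElem.mem_range_iff hP.isIdempotentElem).1 y.2]
  refine ⟨fun x y => ?_, fun x => ?_⟩
  · rw [Submodule.coe_inner, Submodule.coe_inner, coe_compression_apply hP.isIdempotentElem,
      coe_compression_apply hP.isIdempotentElem, hinner, hQ.isSymmetric, ← inner_conj_symm,
      ← hinner, inner_conj_symm]
  · rw [Submodule.coe_inner, coe_compression_apply hP.isIdempotentElem, hinner]
    exact hQ.re_inner_nonneg_left _

lemma trace_compression (hP : IsIdempotentElem P) :
    LinearMap.trace ℂ (LinearMap.range P) (compression P Q) =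
      LinearMap.trace ℂ (EuclideanSpace ℂ (Fin n)) (Q * P) := by
  rw [compression, LinearMap.trace_restrict_eq_of_forall_mem _ _
    fun x => LinearMap.mem_range_self P ((Q * P) x), mul_assoc, LinearMap.trace_mul_comm,
    mul_assoc, hP.eq]

variable {ι : Type*} [Fintype ι] [DecidableEq ι]
  {b : OrthonormalBasis ι ℂ (EuclideanSpace ℂ (Fin n))} {A : Finset ι}

lemma trace_compression_eq_sum_inner (hP : IsIdempotentElem P)
    (hPb : ∀ i, P (b i) = if i ∈ A then b i else 0) :
    LinearMap.trace ℂ (LinearMap.range P) (compression P Q) = ∑ k ∈ A, ⟪b k, Q (b k)⟫_ℂ := by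
  rw [trace_compression hP, LinearMap.trace_eq_sum_inner _ b]
  simp only [Module.End.mul_apply, hPb, apply_ite Q, map_zero, apply_ite (inner ℂ _),
    inner_zero_right, Finset.sum_ite_mem, Finset.univ_inter]

lemma finrank_range_eq_card (hP : IsIdempotentElem P)
    (hPb : ∀ i, P (b i) = if i ∈ A then b i else 0) :
    Module.finrank ℂ (LinearMap.range P) = A.card := by
  have h := trace_compression_eq_sum_inner (Q := 1) hP hPb
  rw [compression_one hP, LinearMap.trace_one] at h
  simp only [Module.End.one_apply, inner_self_eq_norm_sq_to_K, OrthonormalBasis.norm_eq_one,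
    RCLike.ofReal_one, one_pow, Finset.sum_const, nsmul_one] at h
  exact_mod_cast h

lemma re_trace_compression (hP : IsIdempotentElem P) (hQ : Q.IsSymmetricProjection)
    (hPb : ∀ i, P (b i) = if i ∈ A then b i else 0) :
    (LinearMap.trace ℂ (LinearMap.range P) (compression P Q)).re = ∑ k ∈ A, ‖Q (b k)‖ ^ 2 := by
  rw [trace_compression_eq_sum_inner hP hPb, Complex.re_sum]
  exact Finset.sum_congr rfl fun k _ => re_inner_apply_self_eq_sq_norm hQ (b k)

theorem re_trace_compression_mul_one_sub (hP : P.IsSymmetricProjection)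
    (hQ : Q.IsSymmetricProjection) (hPb : ∀ i, P (b i) = if i ∈ A then b i else 0) :
    (LinearMap.trace ℂ (LinearMap.range P) (compression P Q * (1 - compression P Q))).re =
      ∑ k ∈ A, ∑ l ∈ Aᶜ, ‖⟪b l, Q (b k)⟫_ℂ‖ ^ 2 := by
  have hPi := hP.isIdempotentElem
  rw [one_sub_compression hPi, compression_mul_compression hPi,
    trace_compression_eq_sum_inner hPi hPb, Complex.re_sum]
  refine Finset.sum_congr rfl fun k hk => ?_
  have hproj (l : ι) : ⟪b l, P (Q (b k))⟫_ℂ = if l ∈ A then ⟪b l, Q (b k)⟫_ℂ else 0 := by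
    rw [← hP.isSymmetric, hPb]
    split_ifs <;> simp
  have hdiag : ⟪b k, (Q * P * (1 - Q)) (b k)⟫_ℂ =
      ⟪Q (b k), Q (b k)⟫_ℂ - ⟪Q (b k), P (Q (b k))⟫_ℂ := by
    rw [Module.End.mul_apply, Module.End.mul_apply, LinearMap.sub_apply, Module.End.one_apply,
      map_sub, hPb, if_pos hk, ← hQ.isSymmetric, inner_sub_right, hQ.isSymmetric _ (b k),
      hQ.isSymmetric _ (Q (b k)), ← Module.End.mul_apply Q Q, hQ.isIdempotentElem.eq]
  rw [hdiag, ← b.sum_inner_mul_inner, ← b.sum_inner_mul_inner]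
  simp only [hproj, mul_ite, mul_zero, Finset.sum_ite_mem, Finset.univ_inter]
  rw [← Finset.sum_compl_add_sum A, add_sub_cancel_right, Complex.re_sum]
  refine Finset.sum_congr rfl fun l _ => ?_
  rw [← RCLike.re_eq_complex_re, inner_mul_symm_re_eq_norm, norm_mul, norm_inner_symm, sq]

end Compression

section SpectralProjection

variable {n : ℕ} {A : Module.End ℂ (EuclideanSpace ℂ (Fin n))} {S : Set ℝ}

lemma isSymmetricProjection_spectralProjection :
    (spectralProjection A S).IsSymmetricProjection where
  isIdempotentElem := LinearMap.ext fun x =>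
    Submodule.starProjection_eq_self_iff.2 (Submodule.starProjection_apply_mem _ x)
  isSymmetric := Submodule.starProjection_isSymmetric _

lemma spectralProjection_apply_of_mem {x : ℝ} (hx : x ∈ S) {v : EuclideanSpace ℂ (Fin n)}
    (hv : A v = (x : ℂ) • v) : spectralProjection A S v = v :=
  Submodule.starProjection_eq_self_iff.2 <| Submodule.mem_iSup_of_mem x <|
    Submodule.mem_iSup_of_mem hx <| Module.End.mem_eigenspace_iff.2 hv

lemma spectralProjection_apply_of_notMem (hA : A.IsSymmetric) {x : ℝ} (hx : x ∉ S)
    {v : EuclideanSpace ℂ (Fin n)} (hv : A v = (x : ℂ) • v) : spectralProjection A S v = 0 := by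
  refine (Submodule.starProjection_apply_eq_zero_iff _).2 ?_
  have hle : (⨆ y ∈ S, Module.End.eigenspace A (y : ℂ)) ≤ (Module.End.eigenspace A (x : ℂ))ᗮ :=
    iSup₂_le fun y hy => (hA.orthogonalFamily_eigenspaces.isOrtho fun h => hx (by
      rwa [← Complex.ofReal_injective h])).le
  exact Submodule.orthogonal_le hle
    (Submodule.le_orthogonal_orthogonal _ (Module.End.mem_eigenspace_iff.2 hv))

lemma ext_of_eigenvectors (hA : A.IsSymmetric) {B C : Module.End ℂ (EuclideanSpace ℂ (Fin n))}
    (h : ∀ (x : ℝ) v, A v = (x : ℂ) • v → B v = C v) : B = C :=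
  (hA.eigenvectorBasis finrank_euclideanSpace_fin).toBasis.ext fun i => by
    rw [OrthonormalBasis.coe_toBasis]
    exact h _ _ (hA.apply_eigenvectorBasis finrank_euclideanSpace_fin i)

lemma spectralProjection_Ioi_add_Iio_add_singleton (hA : A.IsSymmetric) (x : ℝ) :
    spectralProjection A (Set.Ioi x) + spectralProjection A (Set.Iio x) +
      spectralProjection A {x} = 1 := by
  refine ext_of_eigenvectors hA fun y v hv => ?_
  rw [LinearMap.add_apply, LinearMap.add_apply, Module.End.one_apply]
  rcases lt_trichotomy y x with h | h | h
  · rw [spectralProjection_apply_of_notMem hA (Set.notMem_Ioi.2 h.le) hv,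
      spectralProjection_apply_of_mem (Set.mem_Iio.2 h) hv,
      spectralProjection_apply_of_notMem hA (Set.notMem_singleton_iff.2 h.ne) hv, zero_add,
      add_zero]
  · rw [spectralProjection_apply_of_notMem hA (Set.notMem_Ioi.2 h.le) hv,
      spectralProjection_apply_of_notMem hA (Set.notMem_Iio.2 h.ge) hv,
      spectralProjection_apply_of_mem (Set.mem_singleton_iff.2 h) hv, zero_add, zero_add]
  · rw [spectralProjection_apply_of_mem (Set.mem_Ioi.2 h) hv,
      spectralProjection_apply_of_notMem hA (Set.notMem_Iio.2 h.le) hv,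
      spectralProjection_apply_of_notMem hA (Set.notMem_singleton_iff.2 h.ne') hv, add_zero,
      add_zero]

lemma spectralProjection_neg_mul_of_anticomm (hA : A.IsSymmetric)
    {U : Module.End ℂ (EuclideanSpace ℂ (Fin n))} (hU : A * U = -(U * A)) :
    spectralProjection A (-S) * U = U * spectralProjection A S := by
  refine ext_of_eigenvectors hA fun x v hv => ?_
  have hUv : A (U v) = ((-x : ℝ) : ℂ) • U v := by
    rw [← Module.End.mul_apply, hU, LinearMap.neg_apply, Module.End.mul_apply, hv, map_smul,
      Complex.ofReal_neg, neg_smul]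
  rw [Module.End.mul_apply, Module.End.mul_apply]
  by_cases hx : x ∈ S
  · rw [spectralProjection_apply_of_mem hx hv,
      spectralProjection_apply_of_mem (Set.neg_mem_neg.2 hx) hUv]
  · rw [spectralProjection_apply_of_notMem hA hx hv,
      spectralProjection_apply_of_notMem hA (mt Set.neg_mem_neg.1 hx) hUv, map_zero]

end SpectralProjection

/-- The matrix element `√(k (n - k))` of twice `J₁` between the weight vectors of index `k - 1`
and `k` in the `n`-dimensional representation; it vanishes at `k = 0` and for `n ≤ k`. -/
noncomputable def ladderCoeff (n k : ℕ) : ℝ :=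
  √(k * ((n : ℝ) - k))

lemma ladderCoeff_nonneg (n k : ℕ) : 0 ≤ ladderCoeff n k :=
  Real.sqrt_nonneg _

lemma ladderCoeff_sq {n k : ℕ} (hk : k ≤ n) : ladderCoeff n k ^ 2 = k * ((n : ℝ) - k) :=
  Real.sq_sqrt (mul_nonneg k.cast_nonneg (sub_nonneg.2 (by exact_mod_cast hk)))

lemma ladderCoeff_zero (n : ℕ) : ladderCoeff n 0 = 0 := by
  rw [ladderCoeff, Nat.cast_zero, zero_mul, Real.sqrt_zero]

/-- `v 0, …, v (N - 1)` are the nonzero vectors obtained from a highest weight vector `v 0` of the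
triple `J₁, J₂, J₃` by applying the lowering operator `J₁ - i J₂`. At `k = 0` the truncated `k - 1`
in the action of the raising operator comes with the coefficient `0`. -/
structure IsWeightString {n : ℕ} (J₁ J₂ J₃ : Module.End ℂ (EuclideanSpace ℂ (Fin n))) (N : ℕ)
    (v : ℕ → EuclideanSpace ℂ (Fin n)) : Prop where
  pos : 0 < N
  ne_zero_iff : ∀ k, v k ≠ 0 ↔ k < N
  weight : ∀ k, J₃ (v k) = ((((N : ℝ) - 1) / 2 - k : ℝ) : ℂ) • v k
  lower : ∀ k, (J₁ - Complex.I • J₂) (v k) = v (k + 1)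
  raise : ∀ k, (J₁ + Complex.I • J₂) (v k) = ((k * ((N : ℝ) - k) : ℝ) : ℂ) • v (k - 1)

/-- `e 0, …, e (n - 1)` is an orthonormal eigenbasis of `J₃` with the eigenvalues of the
`n`-dimensional irreducible representation, continued by zero, in which `J₁` is the tridiagonal
matrix of that representation. At `k = 0` the truncated `k - 1` comes with the coefficient `0`. -/
structure IsJacobiBasis {n : ℕ} (J₁ J₃ : Module.End ℂ (EuclideanSpace ℂ (Fin n)))
    (e : ℕ → EuclideanSpace ℂ (Fin n)) : Prop where
  orthonormal : Orthonormal ℂ fun k : Fin n => e k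
  eq_zero : ∀ k, n ≤ k → e k = 0
  weight : ∀ k, J₃ (e k) = ((((n : ℝ) - 1) / 2 - k : ℝ) : ℂ) • e k
  two_smul_apply : ∀ k, (2 : ℂ) • J₁ (e k) =
    (ladderCoeff n k : ℂ) • e (k - 1) + (ladderCoeff n (k + 1) : ℂ) • e (k + 1)

section Representation

attribute [local instance] LieRing.ofAssociativeRing

variable {n : ℕ} {J₁ J₂ J₃ : Module.End ℂ (EuclideanSpace ℂ (Fin n))}

namespace IsSpinTriple

lemma quarterTurn (hJ : IsSpinTriple J₁ J₂ J₃) : IsSpinTriple J₃ (-J₂) J₁ where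
  isSymmetric_one := hJ.isSymmetric_three
  isSymmetric_two v w := by simp [hJ.isSymmetric_two v w]
  isSymmetric_three := hJ.isSymmetric_one
  comm_one_two := by rw [← hJ.comm_two_three]; noncomm_ring
  comm_two_three := by rw [← hJ.comm_one_two]; noncomm_ring
  comm_three_one := by rw [smul_neg, ← hJ.comm_three_one]; noncomm_ring
  irreducible W h₃ h₂ h₁ := hJ.irreducible W h₁
    (fun v hv => by simpa using W.neg_mem (h₂ v hv)) h₃

lemma three_ne_zero (hJ : IsSpinTriple J₁ J₂ J₃) (hn : 1 < n) : J₃ ≠ 0 := by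
  intro h₃
  have h₁ : J₁ = 0 := by simpa [h₃, Complex.I_ne_zero] using hJ.comm_two_three.symm
  have h₂ : J₂ = 0 := by simpa [h₃, Complex.I_ne_zero] using hJ.comm_three_one.symm
  obtain ⟨v, hv⟩ : ∃ v : EuclideanSpace ℂ (Fin n), v ≠ 0 :=
    have : Nonempty (Fin n) := ⟨⟨0, by omega⟩⟩
    exists_ne 0
  rcases hJ.irreducible (ℂ ∙ v) (by simp [h₁]) (by simp [h₂]) (by simp [h₃]) with h | h
  · exact hv (Submodule.span_singleton_eq_bot.1 h)
  · have := finrank_span_singleton (K := ℂ) hv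
    rw [h, finrank_top, finrank_euclideanSpace_fin] at this
    omega

lemma isSl2Triple (hJ : IsSpinTriple J₁ J₂ J₃) (hn : 1 < n) :
    IsSl2Triple ((2 : ℂ) • J₃) (J₁ + Complex.I • J₂) (J₁ - Complex.I • J₂) := by
  have h₁₂ : ⁅J₁, Complex.I • J₂⁆ = -J₃ := by
    rw [lie_smul, LieRing.of_associative_ring_bracket, hJ.comm_one_two, smul_smul,
      Complex.I_mul_I, neg_one_smul]
  have h₃₁ : ⁅J₃, J₁⁆ = Complex.I • J₂ := hJ.comm_three_one
  have h₃₂ : ⁅J₃, Complex.I • J₂⁆ = J₁ := by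
    rw [lie_smul, ← lie_skew, LieRing.of_associative_ring_bracket, hJ.comm_two_three, smul_neg,
      smul_smul, Complex.I_mul_I, neg_one_smul, neg_neg]
  refine ⟨smul_ne_zero two_ne_zero (hJ.three_ne_zero hn), ?_, ?_, ?_⟩
  · rw [lie_sub, add_lie, add_lie, lie_self, lie_self, ← lie_skew _ J₁, h₁₂]
    module
  · rw [smul_lie, lie_add, h₃₁, h₃₂]
    module
  · rw [smul_lie, lie_sub, h₃₁, h₃₂]
    module

theorem exists_isWeightString (hJ : IsSpinTriple J₁ J₂ J₃) (hn : 1 < n) :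
    ∃ N v, IsWeightString J₁ J₂ J₃ N v := by
  have : Nontrivial (EuclideanSpace ℂ (Fin n)) :=
    have : Nonempty (Fin n) := ⟨⟨0, by omega⟩⟩
    inferInstance
  obtain ⟨μ, v₀, -, h₀⟩ := (hJ.isSl2Triple hn).exists_hasPrimitiveVectorWith (R := ℂ)
    (M := EuclideanSpace ℂ (Fin n))
  obtain ⟨d, rfl⟩ := h₀.exists_nat
  have weight := h₀.lie_h_pow_toEnd_f
  have raise := h₀.lie_e_pow_succ_toEnd_f
  have zero := h₀.pow_toEnd_f_eq_zero_of_eq_nat rfl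
  rw [LieModule.toEnd_module_end] at weight raise zero
  simp only [LieHom.id_apply, Module.End.lie_apply] at weight raise zero
  refine ⟨d + 1, fun k => ((J₁ - Complex.I • J₂) ^ k) v₀, d.succ_pos, fun k => ⟨?_, ?_⟩,
    fun k => ?_, fun k => ?_, ?_⟩
  · contrapose!
    intro hk
    obtain ⟨i, rfl⟩ := Nat.exists_eq_add_of_le' hk
    rw [pow_add, Module.End.mul_apply, zero, map_zero]
  · exact fun hk => h₀.pow_toEnd_f_ne_zero_of_eq_nat rfl (Nat.lt_succ_iff.1 hk)
  · refine smul_right_injective _ (two_ne_zero (α := ℂ)) ((weight k).trans ?_)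
    beta_reduce
    rw [smul_smul]
    congr 1
    push_cast
    ring
  · rw [pow_succ', Module.End.mul_apply]
  · rintro (_ | k)
    · simpa using h₀.lie_e
    · refine (raise k).trans ?_
      rw [Nat.add_sub_cancel]
      congr 1
      push_cast
      ring

lemma inner_eq_zero_of_weight_ne (hJ : IsSpinTriple J₁ J₂ J₃) {v w : EuclideanSpace ℂ (Fin n)}
    {x y : ℝ} (hv : J₃ v = (x : ℂ) • v) (hw : J₃ w = (y : ℂ) • w) (hxy : x ≠ y) :
    ⟪v, w⟫_ℂ = 0 :=
  hJ.isSymmetric_three.orthogonalFamily_eigenspaces (by exact_mod_cast hxy)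
    ⟨v, Module.End.mem_eigenspace_iff.2 hv⟩ ⟨w, Module.End.mem_eigenspace_iff.2 hw⟩

lemma inner_lower (hJ : IsSpinTriple J₁ J₂ J₃) (v w : EuclideanSpace ℂ (Fin n)) :
    ⟪(J₁ - Complex.I • J₂) v, w⟫_ℂ = ⟪v, (J₁ + Complex.I • J₂) w⟫_ℂ := by
  simp only [LinearMap.sub_apply, LinearMap.add_apply, LinearMap.smul_apply, inner_sub_left,
    inner_add_right, inner_smul_left, inner_smul_right, hJ.isSymmetric_one v w,
    hJ.isSymmetric_two v w, Complex.conj_I, neg_mul, sub_neg_eq_add]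

end IsSpinTriple

namespace IsWeightString

variable {N : ℕ} {v : ℕ → EuclideanSpace ℂ (Fin n)}

lemma eq_zero (hv : IsWeightString J₁ J₂ J₃ N v) {k : ℕ} (hk : N ≤ k) : v k = 0 :=
  not_ne_iff.1 fun h => ((hv.ne_zero_iff k).1 h).not_ge hk

lemma inner_eq_zero (hv : IsWeightString J₁ J₂ J₃ N v) (hJ : IsSpinTriple J₁ J₂ J₃) {k l : ℕ}
    (hkl : k ≠ l) : ⟪v k, v l⟫_ℂ = 0 :=
  hJ.inner_eq_zero_of_weight_ne (hv.weight k) (hv.weight l) (by simpa using hkl)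

lemma two_smul_one_apply (hv : IsWeightString J₁ J₂ J₃ N v) (k : ℕ) :
    (2 : ℂ) • J₁ (v k) = ((k * ((N : ℝ) - k) : ℝ) : ℂ) • v (k - 1) + v (k + 1) := by
  rw [← hv.raise, ← hv.lower, ← LinearMap.add_apply, ← LinearMap.smul_apply]
  congr 1
  module

lemma two_mul_I_smul_two_apply (hv : IsWeightString J₁ J₂ J₃ N v) (k : ℕ) :
    (2 * Complex.I) • J₂ (v k) = ((k * ((N : ℝ) - k) : ℝ) : ℂ) • v (k - 1) - v (k + 1) := by
  rw [← hv.raise, ← hv.lower, ← LinearMap.sub_apply, ← LinearMap.smul_apply]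
  congr 1
  module

lemma span_eq_top (hv : IsWeightString J₁ J₂ J₃ N v) (hJ : IsSpinTriple J₁ J₂ J₃) :
    Submodule.span ℂ (Set.range v) = ⊤ := by
  set W := Submodule.span ℂ (Set.range v)
  have mem (k : ℕ) : v k ∈ W := Submodule.subset_span ⟨k, rfl⟩
  have invariant {J : Module.End ℂ (EuclideanSpace ℂ (Fin n))} {a : ℂ} (ha : a ≠ 0)
      (h : ∀ k, a • J (v k) ∈ W) : ∀ w ∈ W, J w ∈ W := by
    have : W ≤ W.comap J := Submodule.span_le.2 <| by
      rintro _ ⟨k, rfl⟩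
      exact (W.smul_mem_iff ha).1 (h k)
    exact fun w hw => this hw
  refine (hJ.irreducible W (invariant two_ne_zero fun k => ?_)
    (invariant (mul_ne_zero two_ne_zero Complex.I_ne_zero) fun k => ?_)
    (invariant one_ne_zero fun k => ?_)).resolve_left fun h => ?_
  · rw [hv.two_smul_one_apply]
    exact W.add_mem (W.smul_mem _ (mem _)) (mem _)
  · rw [hv.two_mul_I_smul_two_apply]
    exact W.sub_mem (W.smul_mem _ (mem _)) (mem _)
  · rw [hv.weight, one_smul]
    exact W.smul_mem _ (mem k)
  · exact (hv.ne_zero_iff 0).2 hv.pos ((Submodule.mem_bot ℂ).1 (h ▸ mem 0))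

lemma length_eq (hv : IsWeightString J₁ J₂ J₃ N v) (hJ : IsSpinTriple J₁ J₂ J₃) : N = n := by
  have independent : LinearIndependent ℂ fun k : Fin N => v k :=
    linearIndependent_of_ne_zero_of_inner_eq_zero (fun k => (hv.ne_zero_iff k).2 k.2)
      fun k l hkl => hv.inner_eq_zero hJ (Fin.val_injective.ne hkl)
  have span_eq : Submodule.span ℂ (Set.range fun k : Fin N => v k) = ⊤ := by
    rw [eq_top_iff, ← hv.span_eq_top hJ, Submodule.span_le]
    rintro _ ⟨k, rfl⟩
    rcases lt_or_ge k N with hk | hk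
    · exact Submodule.subset_span ⟨⟨k, hk⟩, rfl⟩
    · rw [hv.eq_zero hk]
      exact Submodule.zero_mem _
  have := finrank_span_eq_card independent
  rwa [span_eq, finrank_top, finrank_euclideanSpace_fin, Fintype.card_fin, eq_comm] at this

lemma norm_succ (hv : IsWeightString J₁ J₂ J₃ N v) (hJ : IsSpinTriple J₁ J₂ J₃) (k : ℕ) :
    ‖v (k + 1)‖ = ladderCoeff N (k + 1) * ‖v k‖ := by
  rcases le_or_gt N k with hk | hk
  · rw [hv.eq_zero hk, hv.eq_zero (hk.trans k.le_succ), norm_zero, mul_zero]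
  have inner_self :
      ⟪v (k + 1), v (k + 1)⟫_ℂ = ((ladderCoeff N (k + 1) ^ 2 : ℝ) : ℂ) * ⟪v k, v k⟫_ℂ := by
    conv_lhs => rw [← hv.lower k, hJ.inner_lower, hv.lower, hv.raise, inner_smul_right]
    rw [ladderCoeff_sq hk, Nat.add_sub_cancel]
  rw [inner_self_eq_norm_sq_to_K, inner_self_eq_norm_sq_to_K] at inner_self
  rw [← sq_eq_sq₀ (norm_nonneg _) (mul_nonneg (ladderCoeff_nonneg _ _) (norm_nonneg _)), mul_pow]
  exact Complex.ofReal_injective (by push_cast at inner_self ⊢; exact inner_self)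

lemma isJacobiBasis_normalize (hv : IsWeightString J₁ J₂ J₃ n v) (hJ : IsSpinTriple J₁ J₂ J₃) :
    IsJacobiBasis J₁ J₃ fun k => ((‖v k‖⁻¹ : ℝ) : ℂ) • v k where
  orthonormal := by
    refine ⟨fun k => ?_, fun k l hkl => ?_⟩
    · have := norm_ne_zero_iff.2 ((hv.ne_zero_iff k).2 k.2)
      rw [norm_smul, Complex.norm_real, norm_inv, norm_norm, inv_mul_cancel₀ this]
    · simp only [inner_smul_left, inner_smul_right,
        hv.inner_eq_zero hJ (Fin.val_injective.ne hkl), mul_zero]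
  eq_zero k hk := by rw [hv.eq_zero hk, smul_zero]
  weight k := by rw [map_smul, hv.weight, smul_comm]
  two_smul_apply k := by
    rw [map_smul, smul_comm, hv.two_smul_one_apply, smul_add]
    congr 1
    · rcases k with _ | k
      · simp [ladderCoeff_zero]
      rcases le_or_gt n k with hk | hk
      · simp [hv.eq_zero hk]
      rw [smul_smul, smul_smul, ← ladderCoeff_sq hk, hv.norm_succ hJ, ← Complex.ofReal_mul,
        ← Complex.ofReal_mul, Nat.add_sub_cancel]
      by_cases hc : ladderCoeff n (k + 1) = 0
      · simp [hc]
      · field_simp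
    · by_cases h : v (k + 1) = 0
      · simp [h]
      have := norm_ne_zero_iff.2 h
      rw [hv.norm_succ hJ] at this ⊢
      rw [smul_smul, ← Complex.ofReal_mul, mul_inv, mul_inv_cancel_left₀ (left_ne_zero_of_mul this)]

end IsWeightString

theorem IsSpinTriple.exists_isJacobiBasis (hJ : IsSpinTriple J₁ J₂ J₃) (hn : 1 < n) :
    ∃ e, IsJacobiBasis J₁ J₃ e := by
  obtain ⟨N, v, hv⟩ := hJ.exists_isWeightString hn
  obtain rfl := hv.length_eq hJ
  exact ⟨_, hv.isJacobiBasis_normalize hJ⟩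

end Representation

lemma ladderCoeff_le (n k : ℕ) : ladderCoeff n k ≤ n / 2 :=
  Real.sqrt_le_iff.2 ⟨by positivity, by nlinarith [sq_nonneg ((k : ℝ) - (n - k))]⟩

namespace IsJacobiBasis

variable {n : ℕ} {J₁ J₃ : Module.End ℂ (EuclideanSpace ℂ (Fin n))}
  {e f : ℕ → EuclideanSpace ℂ (Fin n)}

/-- The orthonormal basis `e 0, …, e (n - 1)`. -/
noncomputable def orthonormalBasis (he : IsJacobiBasis J₁ J₃ e) :
    OrthonormalBasis (Fin n) ℂ (EuclideanSpace ℂ (Fin n)) :=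
  OrthonormalBasis.mk he.orthonormal
    (he.orthonormal.linearIndependent.span_eq_top_of_card_eq_finrank' (by simp)).ge

lemma orthonormalBasis_apply (he : IsJacobiBasis J₁ J₃ e) (k : Fin n) :
    he.orthonormalBasis k = e k := by
  rw [orthonormalBasis, OrthonormalBasis.coe_mk]

lemma linearMap_ext (he : IsJacobiBasis J₁ J₃ e) {V : Type*} [AddCommGroup V] [Module ℂ V]
    {S T : EuclideanSpace ℂ (Fin n) →ₗ[ℂ] V} (h : ∀ k < n, S (e k) = T (e k)) : S = T := by
  refine he.orthonormalBasis.toBasis.ext fun k => ?_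
  rw [OrthonormalBasis.coe_toBasis, he.orthonormalBasis_apply, h k k.2]

lemma norm_le_one (he : IsJacobiBasis J₁ J₃ e) (k : ℕ) : ‖e k‖ ≤ 1 := by
  rcases lt_or_ge k n with hk | hk
  · exact (he.orthonormal.1 ⟨k, hk⟩).le
  · rw [he.eq_zero k hk, norm_zero]
    exact zero_le_one

lemma inner_eq_ite (he : IsJacobiBasis J₁ J₃ e) (k : ℕ) {l : ℕ} (hl : l < n) :
    ⟪e k, e l⟫_ℂ = if k = l then 1 else 0 := by
  rcases lt_or_ge k n with hk | hk
  · simpa using orthonormal_iff_ite.1 he.orthonormal ⟨k, hk⟩ ⟨l, hl⟩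
  · rw [he.eq_zero k hk, inner_zero_left, if_neg (by omega)]

lemma sum_sq_norm_inner (he : IsJacobiBasis J₁ J₃ e) (v : EuclideanSpace ℂ (Fin n)) :
    ∑ k ∈ Finset.range n, ‖⟪e k, v⟫_ℂ‖ ^ 2 = ‖v‖ ^ 2 := by
  rw [← he.orthonormalBasis.sum_sq_norm_inner_right, Finset.sum_range]
  simp only [he.orthonormalBasis_apply]

lemma spectralProjection_apply (he : IsJacobiBasis J₁ J₃ e) (hJ : J₃.IsSymmetric) (S : Set ℝ)
    [DecidablePred (· ∈ S)] (k : ℕ) :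
    spectralProjection J₃ S (e k) = if ((n : ℝ) - 1) / 2 - k ∈ S then e k else 0 := by
  split_ifs with h
  · exact spectralProjection_apply_of_mem h (he.weight k)
  · exact spectralProjection_apply_of_notMem hJ h (he.weight k)

lemma two_smul_commutator (he : IsJacobiBasis J₁ J₃ e)
    {Q : Module.End ℂ (EuclideanSpace ℂ (Fin n))} {m : ℕ}
    (hQ : ∀ k, Q (e k) = if k < m then e k else 0) (v : EuclideanSpace ℂ (Fin n)) :
    (2 : ℂ) • (J₁ (Q v) - Q (J₁ v)) =
      (ladderCoeff n m : ℂ) • (⟪e (m - 1), v⟫_ℂ • e m - ⟪e m, v⟫_ℂ • e (m - 1)) := by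
  suffices (2 : ℂ) • (J₁ * Q - Q * J₁) = (ladderCoeff n m : ℂ) •
      ((innerₛₗ ℂ (e (m - 1))).smulRight (e m) - (innerₛₗ ℂ (e m)).smulRight (e (m - 1))) from
    LinearMap.congr_fun this v
  refine he.linearMap_ext fun k hk => ?_
  simp only [LinearMap.smul_apply, LinearMap.sub_apply, Module.End.mul_apply,
    LinearMap.smulRight_apply, innerₛₗ_apply_apply, he.inner_eq_ite _ hk, smul_sub, ← map_smul Q]
  rw [he.two_smul_apply, map_add, map_smul, map_smul, hQ, hQ, hQ]
  rcases m with _ | m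
  · simp [ladderCoeff_zero]
  rcases lt_trichotomy k m with h | rfl | h
  · simp [h, h.ne', he.two_smul_apply, show m + 1 ≠ k by omega, show k < m + 1 by omega,
      show k ≤ m + 1 by omega]
  · simp [he.two_smul_apply]
  rcases Nat.eq_or_lt_of_le h with rfl | h'
  · simp
  · simp [h.ne, h'.ne, show ¬k < m + 1 by omega, show ¬k ≤ m + 1 by omega,
      show ¬k + 1 < m + 1 by omega]

lemma abs_sub_mul_norm_inner_le (he : IsJacobiBasis J₁ J₃ e) (hf : IsJacobiBasis J₃ J₁ f)
    (hJ : J₃.IsSymmetric) {Q : Module.End ℂ (EuclideanSpace ℂ (Fin n))} {m : ℕ}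
    (hQ : ∀ k, Q (f k) = if k < m then f k else 0) (k l : ℕ) :
    |(k : ℝ) - l| * ‖⟪e k, Q (e l)⟫_ℂ‖ ≤ n / 4 *
      (‖⟪e k, f (m - 1)⟫_ℂ‖ * ‖⟪e l, f m⟫_ℂ‖ + ‖⟪e k, f m⟫_ℂ‖ * ‖⟪e l, f (m - 1)⟫_ℂ‖) := by
  have commutator : 2 * ((((l : ℝ) - k : ℝ) : ℂ) * ⟪e k, Q (e l)⟫_ℂ) = ladderCoeff n m *
      (⟪f (m - 1), e l⟫_ℂ * ⟪e k, f m⟫_ℂ - ⟪f m, e l⟫_ℂ * ⟪e k, f (m - 1)⟫_ℂ) := by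
    have := congrArg (⟪e k, ·⟫_ℂ) (hf.two_smul_commutator hQ (e l))
    simp only [inner_smul_right, inner_sub_right, ← hJ (e k), he.weight, map_smul, inner_smul_left,
      Complex.conj_ofReal] at this
    rw [← this]
    push_cast
    ring
  have norm_eq := congrArg norm commutator
  rw [norm_mul, norm_mul, norm_mul, Complex.norm_real, Complex.norm_real, Complex.norm_two,
    Real.norm_of_nonneg (ladderCoeff_nonneg n m), Real.norm_eq_abs, abs_sub_comm] at norm_eq
  have triangle := norm_sub_le (⟪f (m - 1), e l⟫_ℂ * ⟪e k, f m⟫_ℂ)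
    (⟪f m, e l⟫_ℂ * ⟪e k, f (m - 1)⟫_ℂ)
  rw [norm_mul, norm_mul, norm_inner_symm (f m), norm_inner_symm (f (m - 1))] at triangle
  have := mul_le_mul (ladderCoeff_le n m) triangle (norm_nonneg _) (by positivity)
  linarith

end IsJacobiBasis

section Recursion

lemma norm_le_of_three_term {s s' μ η : ℝ} {x y z : ℂ} (hs : 0 ≤ s) (hs' : 0 < s')
    (hss' : s ≤ (1 + η) * s') (hμ : |2 * μ| ≤ η * s') (h : 2 * μ * y = s * x + s' * z) :
    ‖z‖ ≤ (1 + η) * ‖x‖ + η * ‖y‖ := by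
  refine le_of_mul_le_mul_left ?_ hs'
  calc s' * ‖z‖ = ‖((2 * μ : ℝ) : ℂ) * y - (s : ℂ) * x‖ := by
        rw [← Real.norm_of_nonneg hs'.le, ← Complex.norm_real, ← norm_mul]
        congr 1
        push_cast
        linear_combination -h
    _ ≤ |2 * μ| * ‖y‖ + s * ‖x‖ := by
        refine (norm_sub_le _ _).trans_eq ?_
        rw [norm_mul, norm_mul, Complex.norm_real, Complex.norm_real, Real.norm_of_nonneg hs,
          Real.norm_eq_abs]
    _ ≤ η * s' * ‖y‖ + (1 + η) * s' * ‖x‖ := by gcongr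
    _ = s' * ((1 + η) * ‖x‖ + η * ‖y‖) := by ring

lemma le_pow_mul_of_le_mul_succ {E : ℕ → ℝ} {r : ℝ} (hr : 1 ≤ r) (hE : ∀ k, 0 ≤ E k) {a b : ℕ}
    (hup : ∀ k, a ≤ k → k < b → E (k + 1) ≤ r * E k)
    (hdown : ∀ k, a ≤ k → k < b → E k ≤ r * E (k + 1)) {k l : ℕ} (hk : k ∈ Set.Icc a b)
    (hl : l ∈ Set.Icc a b) : E k ≤ r ^ b * E l := by
  have step (i d : ℕ) (hi : a ≤ i) (hd : i + d ≤ b) :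
      E (i + d) ≤ r ^ d * E i ∧ E i ≤ r ^ d * E (i + d) := by
    induction d with
    | zero => simp
    | succ d ih =>
      obtain ⟨ih_up, ih_down⟩ := ih (by omega)
      have up := hup (i + d) (by omega) (by omega)
      have down := hdown (i + d) (by omega) (by omega)
      rw [← add_assoc, pow_succ]
      constructor
      · rw [mul_comm (r ^ d), mul_assoc]
        exact up.trans (by gcongr)
      · rw [mul_assoc]
        exact ih_down.trans (by gcongr)
  rcases le_total k l with h | h <;> obtain ⟨d, rfl⟩ := Nat.exists_eq_add_of_le h
  · refine (step k d hk.1 hl.2).2.trans ?_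
    gcongr
    exacts [hE _, (Nat.le_add_left d k).trans hl.2]
  · refine (step l d hl.1 hk.2).1.trans ?_
    gcongr
    exacts [hE _, (Nat.le_add_left d l).trans hk.2]

lemma mul_sq_le_sum_Icc {x : ℕ → ℝ} {y R : ℝ} (hy : 0 ≤ y) {a b : ℕ}
    (h : ∀ l ∈ Finset.Ico a b, y ≤ R * (x l + x (l + 1))) :
    ((b - a : ℕ) : ℝ) * y ^ 2 ≤ 4 * R ^ 2 * ∑ l ∈ Finset.Icc a b, x l ^ 2 := by
  have pointwise (l : ℕ) (hl : l ∈ Finset.Ico a b) :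
      y ^ 2 ≤ 2 * R ^ 2 * (x l ^ 2 + x (l + 1) ^ 2) := calc
    y ^ 2 ≤ (R * (x l + x (l + 1))) ^ 2 := pow_le_pow_left₀ hy (h l hl) 2
    _ = R ^ 2 * (x l + x (l + 1)) ^ 2 := mul_pow _ _ _
    _ ≤ R ^ 2 * (2 * (x l ^ 2 + x (l + 1) ^ 2)) := by gcongr; exact add_sq_le
    _ = _ := by ring
  have left : ∑ l ∈ Finset.Ico a b, x l ^ 2 ≤ ∑ l ∈ Finset.Icc a b, x l ^ 2 :=
    Finset.sum_le_sum_of_subset_of_nonneg Finset.Ico_subset_Icc_self fun _ _ _ => sq_nonneg _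
  have right : ∑ l ∈ Finset.Ico a b, x (l + 1) ^ 2 ≤ ∑ l ∈ Finset.Icc a b, x l ^ 2 := by
    rw [Finset.sum_Ico_add' (fun l => x l ^ 2) a b 1]
    refine Finset.sum_le_sum_of_subset_of_nonneg (fun l hl => ?_) fun _ _ _ => sq_nonneg _
    rw [Finset.mem_Ico] at hl
    exact Finset.mem_Icc.2 (by omega)
  have sum := Finset.sum_le_sum pointwise
  rw [Finset.sum_const, nsmul_eq_mul, Nat.card_Ico, ← Finset.mul_sum, Finset.sum_add_distrib]
    at sum
  nlinarith [sq_nonneg R]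

lemma mul_sq_le_sum_Icc_of_three_term {x : ℕ → ℝ} (hx : ∀ k, 0 ≤ x k) {η : ℝ} (hη : 0 ≤ η)
    {a b : ℕ} (hup : ∀ k, a ≤ k → k + 2 ≤ b → x (k + 2) ≤ (1 + η) * x k + η * x (k + 1))
    (hdown : ∀ k, a ≤ k → k + 2 ≤ b → x k ≤ (1 + η) * x (k + 2) + η * x (k + 1))
    {k : ℕ} (hk : k ∈ Set.Icc a b) :
    ((b - a : ℕ) : ℝ) * x k ^ 2 ≤
      4 * Real.exp (b * η) ^ 2 * ∑ l ∈ Finset.Icc a b, x l ^ 2 := by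
  rcases Nat.eq_zero_or_pos (b - a) with hab | hab
  · rw [hab, Nat.cast_zero, zero_mul]
    positivity
  refine mul_sq_le_sum_Icc (hx k) fun l hl => ?_
  rw [Finset.mem_Ico] at hl
  obtain ⟨i, hi, hki⟩ : ∃ i ∈ Set.Icc a (b - 1), x k ≤ x i + x (i + 1) := by
    rcases Nat.lt_or_ge k b with hkb | hkb
    · exact ⟨k, ⟨hk.1, by omega⟩, le_add_of_nonneg_right (hx _)⟩
    · obtain rfl : k = b := le_antisymm hk.2 hkb
      refine ⟨k - 1, ⟨by omega, le_rfl⟩, ?_⟩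
      rw [Nat.sub_add_cancel (by omega)]
      exact le_add_of_nonneg_left (hx _)
  have growth : (1 + η) ^ (b - 1) ≤ Real.exp (b * η) := calc
    (1 + η) ^ (b - 1) ≤ Real.exp η ^ (b - 1) := by
      gcongr
      rw [add_comm]
      exact Real.add_one_le_exp η
    _ ≤ Real.exp η ^ b := pow_le_pow_right₀ (Real.one_le_exp hη) (Nat.sub_le b 1)
    _ = Real.exp (b * η) := (Real.exp_nat_mul η b).symm
  -- The recursion makes `x k + x (k + 1)` almost constant.
  calc x k ≤ x i + x (i + 1) := hki
    _ ≤ (1 + η) ^ (b - 1) * (x l + x (l + 1)) :=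
        le_pow_mul_of_le_mul_succ (E := fun k => x k + x (k + 1)) (by linarith)
          (fun k => add_nonneg (hx _) (hx _))
          (fun k ha hb => by linarith [hup k ha (by omega)])
          (fun k ha hb => by linarith [hdown k ha (by omega)]) hi ⟨hl.1, by omega⟩
    _ ≤ Real.exp (b * η) * (x l + x (l + 1)) :=
        mul_le_mul_of_nonneg_right growth (add_nonneg (hx _) (hx _))

end Recursion

lemma le_ladderCoeff {n k p : ℕ} (hpk : p ≤ k) (hkp : k + p ≤ n) : (p : ℝ) ≤ ladderCoeff n k := by
  have hpk : (p : ℝ) ≤ k := by exact_mod_cast hpk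
  have hkp : (p : ℝ) ≤ n - k := by rw [le_sub_iff_add_le']; exact_mod_cast hkp
  refine Real.le_sqrt_of_sq_le ?_
  rw [sq]
  exact mul_le_mul hpk hkp p.cast_nonneg k.cast_nonneg

lemma abs_ladderCoeff_succ_sub_le {n k p : ℕ} (hp : 0 < p) (hpk : p ≤ k) (hkp : k + 1 + p ≤ n) :
    |ladderCoeff n (k + 1) - ladderCoeff n k| ≤ n / p := by
  have hp : (0 : ℝ) < p := by exact_mod_cast hp
  have hkn : (k : ℝ) + 1 ≤ n := by exact_mod_cast (by omega : k + 1 ≤ n)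
  have lower : (p : ℝ) ≤ ladderCoeff n k := le_ladderCoeff hpk (by omega)
  rw [le_div_iff₀ hp]
  calc |ladderCoeff n (k + 1) - ladderCoeff n k| * p
      ≤ |ladderCoeff n (k + 1) - ladderCoeff n k| *
          (ladderCoeff n (k + 1) + ladderCoeff n k) := by
        gcongr
        linarith [ladderCoeff_nonneg n (k + 1)]
    _ = |ladderCoeff n (k + 1) ^ 2 - ladderCoeff n k ^ 2| := by
        rw [sq_sub_sq, abs_mul, mul_comm,
          abs_of_nonneg (add_nonneg (ladderCoeff_nonneg _ _) (ladderCoeff_nonneg _ _))]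
    _ = |(n : ℝ) - 1 - 2 * k| := by
        rw [ladderCoeff_sq (by omega), ladderCoeff_sq (by omega)]
        congr 1
        push_cast
        ring
    _ ≤ n := abs_le.2 ⟨by linarith, by linarith [k.cast_nonneg (α := ℝ)]⟩

namespace IsJacobiBasis

variable {n : ℕ} {J₁ J₃ : Module.End ℂ (EuclideanSpace ℂ (Fin n))}
  {e : ℕ → EuclideanSpace ℂ (Fin n)}

lemma three_term (he : IsJacobiBasis J₁ J₃ e) (hJ : J₁.IsSymmetric) {μ : ℝ}
    {v : EuclideanSpace ℂ (Fin n)} (hv : J₁ v = (μ : ℂ) • v) (k : ℕ) :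
    2 * μ * ⟪e k, v⟫_ℂ =
      ladderCoeff n k * ⟪e (k - 1), v⟫_ℂ + ladderCoeff n (k + 1) * ⟪e (k + 1), v⟫_ℂ := by
  have := congrArg (⟪·, v⟫_ℂ) (he.two_smul_apply k)
  simp only [inner_add_left, inner_smul_left, Complex.conj_ofReal, hJ _ v, hv, inner_smul_right,
    Complex.conj_ofNat] at this
  rw [← this, mul_assoc]

lemma norm_inner_le_of_bulk (he : IsJacobiBasis J₁ J₃ e) (hJ : J₁.IsSymmetric) {μ : ℝ}
    (hμ : |μ| ≤ 1) {v : EuclideanSpace ℂ (Fin n)} (hv : J₁ v = (μ : ℂ) • v) {p : ℕ} (hp : 0 < p)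
    (hpn : 2 * p ≤ n) {k : ℕ} (hpk : p ≤ k) (hkp : k + 2 + p ≤ n) :
    ‖⟪e (k + 2), v⟫_ℂ‖ ≤
        (1 + n / p ^ 2) * ‖⟪e k, v⟫_ℂ‖ + n / p ^ 2 * ‖⟪e (k + 1), v⟫_ℂ‖ ∧
      ‖⟪e k, v⟫_ℂ‖ ≤
        (1 + n / p ^ 2) * ‖⟪e (k + 2), v⟫_ℂ‖ + n / p ^ 2 * ‖⟪e (k + 1), v⟫_ℂ‖ := by
  have hp' : (0 : ℝ) < p := by exact_mod_cast hp
  have hpn' : 2 * (p : ℝ) ≤ n := by exact_mod_cast hpn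
  have div_le {s : ℝ} (hs : p ≤ s) : (n : ℝ) / p ≤ n / p ^ 2 * s := calc
    (n : ℝ) / p = n / p ^ 2 * p := by field_simp
    _ ≤ n / p ^ 2 * s := by gcongr
  have ratio {s s' : ℝ} (hs' : p ≤ s') (h : |s - s'| ≤ n / p) : s ≤ (1 + n / p ^ 2) * s' := by
    linarith [(abs_le.1 h).2, div_le hs']
  have energy {s : ℝ} (hs : p ≤ s) : |2 * μ| ≤ n / p ^ 2 * s := by
    refine le_trans ?_ (div_le hs)
    rw [abs_mul, abs_two, le_div_iff₀ hp']
    nlinarith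
  have lower₁ := le_ladderCoeff (hpk.trans k.le_succ) (by omega : k + 1 + p ≤ n)
  have lower₂ := le_ladderCoeff (hpk.trans (k.le_add_right 2)) hkp
  have variation := abs_ladderCoeff_succ_sub_le hp (hpk.trans k.le_succ) hkp
  have recursion := he.three_term hJ hv (k + 1)
  exact ⟨norm_le_of_three_term (ladderCoeff_nonneg _ _) (hp'.trans_le lower₂)
      (ratio lower₂ (by rwa [abs_sub_comm])) (energy lower₂) recursion,
    norm_le_of_three_term (ladderCoeff_nonneg _ _) (hp'.trans_le lower₁)
      (ratio lower₁ variation) (energy lower₁) (recursion.trans (add_comm _ _))⟩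

theorem mul_sq_norm_inner_le (he : IsJacobiBasis J₁ J₃ e) (hJ : J₁.IsSymmetric) {μ : ℝ}
    (hμ : |μ| ≤ 1) {v : EuclideanSpace ℂ (Fin n)} (hv : J₁ v = (μ : ℂ) • v) {p : ℕ} (hp : 0 < p)
    (hpn : 4 * p ≤ n) {r : ℝ} (hr : n ≤ r * p) {k : ℕ} (hpk : p ≤ k) (hkp : k + p ≤ n) :
    n * ‖⟪e k, v⟫_ℂ‖ ^ 2 ≤ 8 * Real.exp (2 * r ^ 2) * ‖v‖ ^ 2 := by
  have hp' : (0 : ℝ) < p := by exact_mod_cast hp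
  have hpn' : 4 * (p : ℝ) ≤ n := by exact_mod_cast hpn
  have bulk_sum := mul_sq_le_sum_Icc_of_three_term (x := fun i => ‖⟪e i, v⟫_ℂ‖)
    (fun i => norm_nonneg _) (by positivity : 0 ≤ (n : ℝ) / p ^ 2)
    (fun i h₁ h₂ => (he.norm_inner_le_of_bulk hJ hμ hv hp (by omega) h₁ (by omega)).1)
    (fun i h₁ h₂ => (he.norm_inner_le_of_bulk hJ hμ hv hp (by omega) h₁ (by omega)).2)
    (k := k) (b := n - p) ⟨hpk, by omega⟩
  have bessel : ∑ i ∈ Finset.Icc p (n - p), ‖⟪e i, v⟫_ℂ‖ ^ 2 ≤ ‖v‖ ^ 2 := by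
    rw [← he.sum_sq_norm_inner v]
    refine Finset.sum_le_sum_of_subset_of_nonneg (fun i hi => ?_) fun _ _ _ => sq_nonneg _
    rw [Finset.mem_Icc] at hi
    exact Finset.mem_range.2 (by omega)
  have half : (n : ℝ) / 2 ≤ ((n - p - p : ℕ) : ℝ) := by
    rw [Nat.cast_sub (by omega), Nat.cast_sub (by omega)]
    linarith
  have exponent : Real.exp (((n - p : ℕ) : ℝ) * (n / p ^ 2)) ^ 2 ≤ Real.exp (2 * r ^ 2) := by
    rw [← Real.exp_nat_mul, Real.exp_le_exp, Nat.cast_two]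
    gcongr
    calc ((n - p : ℕ) : ℝ) * ((n : ℝ) / p ^ 2) ≤ n * (n / p ^ 2) := by gcongr; exact Nat.sub_le n p
      _ = ((n : ℝ) / p) ^ 2 := by ring
      _ ≤ r ^ 2 := by gcongr; exact (div_le_iff₀ hp').2 hr
  calc n * ‖⟪e k, v⟫_ℂ‖ ^ 2 = 2 * (n / 2 * ‖⟪e k, v⟫_ℂ‖ ^ 2) := by ring
    _ ≤ 2 * (((n - p - p : ℕ) : ℝ) * ‖⟪e k, v⟫_ℂ‖ ^ 2) := by gcongr
    _ ≤ 2 * (4 * Real.exp (2 * r ^ 2) * ‖v‖ ^ 2) := by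
        refine mul_le_mul_of_nonneg_left (bulk_sum.trans ?_) zero_le_two
        gcongr
    _ = _ := by ring

end IsJacobiBasis

section BoundarySum

lemma sum_Ico_Ico_inv_sq_sub_le (a b c : ℕ) :
    ∑ k ∈ Finset.Ico a b, ∑ l ∈ Finset.Ico b c, (((k : ℝ) - l) ^ 2)⁻¹ ≤
      2 * (1 + Real.log b) := by
  have inner_sum (k : ℕ) (hk : k < b) :
      ∑ l ∈ Finset.Ico b c, (((k : ℝ) - l) ^ 2)⁻¹ ≤ 2 * (((b - 1 - k : ℕ) : ℝ) + 1)⁻¹ := by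
    have shift : Finset.Ico b c = (Finset.Ioo (b - 1 - k) (c - k)).map (addRightEmbedding k) := by
      ext l
      simp only [Finset.mem_Ico, Finset.map_add_right_Ioo, Finset.mem_Ioo]
      omega
    rw [← div_eq_mul_inv, shift, Finset.sum_map]
    refine le_of_eq_of_le (Finset.sum_congr rfl fun i _ => ?_)
      (sum_Ioo_inv_sq_le (b - 1 - k) (c - k))
    simp
  calc ∑ k ∈ Finset.Ico a b, ∑ l ∈ Finset.Ico b c, (((k : ℝ) - l) ^ 2)⁻¹
      ≤ ∑ k ∈ Finset.Ico a b, 2 * (((b - 1 - k : ℕ) : ℝ) + 1)⁻¹ :=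
        Finset.sum_le_sum fun k hk => inner_sum k (Finset.mem_Ico.1 hk).2
    _ ≤ ∑ k ∈ Finset.range b, 2 * (((b - 1 - k : ℕ) : ℝ) + 1)⁻¹ :=
        Finset.sum_le_sum_of_subset_of_nonneg
          (fun k hk => Finset.mem_range.2 (Finset.mem_Ico.1 hk).2) fun _ _ _ => by positivity
    _ = 2 * ((harmonic b : ℚ) : ℝ) := by
        rw [Finset.sum_range_reflect (fun i : ℕ => 2 * ((i : ℝ) + 1)⁻¹) b, ← Finset.mul_sum,
          harmonic]
        push_cast
        rfl
    _ ≤ 2 * (1 + Real.log b) := by gcongr; exact harmonic_le_one_add_log b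

lemma sum_Ico_sdiff_inv_sq_sub_le {a b n : ℕ} (hab : a ≤ b) (hbn : b ≤ n) :
    ∑ k ∈ Finset.Ico a b, ∑ l ∈ Finset.range n \ Finset.Ico a b, (((k : ℝ) - l) ^ 2)⁻¹ ≤
      4 * (1 + Real.log n) := by
  have log_le {c : ℕ} (hc : c ≤ n) : Real.log c ≤ Real.log n := by
    rcases Nat.eq_zero_or_pos c with rfl | h
    · simpa using Real.log_natCast_nonneg n
    · gcongr
  have split : Finset.range n \ Finset.Ico a b = Finset.Ico 0 a ∪ Finset.Ico b n := by
    ext l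
    simp only [Finset.mem_sdiff, Finset.mem_range, Finset.mem_Ico, Finset.mem_union]
    omega
  have disjoint : Disjoint (Finset.Ico 0 a) (Finset.Ico b n) :=
    Finset.disjoint_left.2 fun l h₁ h₂ => by
      rw [Finset.mem_Ico] at h₁ h₂
      omega
  have above := sum_Ico_Ico_inv_sq_sub_le a b n
  have below : ∑ k ∈ Finset.Ico a b, ∑ l ∈ Finset.Ico 0 a, (((k : ℝ) - l) ^ 2)⁻¹ ≤
      2 * (1 + Real.log a) := by
    rw [Finset.sum_comm]
    simp only [sub_sq_comm]
    exact sum_Ico_Ico_inv_sq_sub_le 0 a b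
  simp only [split, Finset.sum_union disjoint, Finset.sum_add_distrib]
  linarith [log_le hbn, log_le (hab.trans hbn)]

lemma sq_mul_sq_le_of_abs_mul_le {x g c u w u' w' : ℝ} (hg : 0 ≤ g)
    (h : |x| * g ≤ c * (u * w' + w * u')) :
    x ^ 2 * g ^ 2 ≤ 2 * c ^ 2 * (u ^ 2 * w' ^ 2 + w ^ 2 * u' ^ 2) := calc
  x ^ 2 * g ^ 2 = (|x| * g) ^ 2 := by rw [mul_pow, sq_abs]
  _ ≤ (c * (u * w' + w * u')) ^ 2 := pow_le_pow_left₀ (mul_nonneg (abs_nonneg x) hg) h 2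
  _ = c ^ 2 * (u * w' + w * u') ^ 2 := mul_pow _ _ _
  _ ≤ c ^ 2 * (2 * ((u * w') ^ 2 + (w * u') ^ 2)) := by gcongr; exact add_sq_le
  _ = _ := by ring

lemma sq_le_of_near_or_far {n r C x g u w u' w' p : ℝ} (hp : 0 < p) (hr : n ≤ r * p) (hn : 0 ≤ n)
    (hx : x ≠ 0) (hg : 0 ≤ g)
    (h : |x| * g ≤ n / 4 * (u * w' + w * u'))
    (h' : p ≤ |x| ∨ n * u ^ 2 ≤ C ∧ n * w ^ 2 ≤ C ∧ n * u' ^ 2 ≤ C ∧ n * w' ^ 2 ≤ C) :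
    g ^ 2 ≤ r ^ 2 / 8 * (u ^ 2 * w' ^ 2 + w ^ 2 * u' ^ 2) + C ^ 2 / 4 * (x ^ 2)⁻¹ := by
  have decay := sq_mul_sq_le_of_abs_mul_le hg h
  have hx2 : 0 < x ^ 2 := by positivity
  rcases h' with far | ⟨hu, hw, hu', hw'⟩
  · refine le_add_of_le_of_nonneg ?_ (by positivity)
    refine le_of_mul_le_mul_left ?_ (sq_pos_of_pos hp)
    calc p ^ 2 * g ^ 2 ≤ |x| ^ 2 * g ^ 2 := by gcongr
      _ ≤ 2 * (n / 4) ^ 2 * (u ^ 2 * w' ^ 2 + w ^ 2 * u' ^ 2) := by rwa [sq_abs]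
      _ ≤ 2 * ((r * p) / 4) ^ 2 * (u ^ 2 * w' ^ 2 + w ^ 2 * u' ^ 2) := by gcongr
      _ = _ := by ring
  · have hC : 0 ≤ C := le_trans (by positivity) hu
    refine le_add_of_nonneg_of_le (by positivity) ?_
    rw [← div_eq_mul_inv, le_div_iff₀ hx2, mul_comm]
    have h₁ := mul_le_mul hu hw' (by positivity) hC
    have h₂ := mul_le_mul hw hu' (by positivity) hC
    nlinarith

theorem sum_boundary_sq_le {n a b : ℕ} (hab : a ≤ b) (hbn : b ≤ n) {p r C : ℝ} (hp : 0 < p)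
    (hr : n ≤ r * p) {g : ℕ → ℕ → ℝ} (hg : ∀ k l, 0 ≤ g k l) {u w : ℕ → ℝ}
    (hu : ∑ k ∈ Finset.range n, u k ^ 2 ≤ 1) (hw : ∑ k ∈ Finset.range n, w k ^ 2 ≤ 1)
    (decay : ∀ k l : ℕ, |(k : ℝ) - l| * g k l ≤ n / 4 * (u k * w l + w k * u l))
    (near_or_far : ∀ k ∈ Finset.Ico a b, ∀ l ∈ Finset.range n \ Finset.Ico a b,
      p ≤ |(k : ℝ) - l| ∨
        n * u k ^ 2 ≤ C ∧ n * w k ^ 2 ≤ C ∧ n * u l ^ 2 ≤ C ∧ n * w l ^ 2 ≤ C) :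
    ∑ k ∈ Finset.Ico a b, ∑ l ∈ Finset.range n \ Finset.Ico a b, g k l ^ 2 ≤
      r ^ 2 / 4 + C ^ 2 * (1 + Real.log n) := by
  have pointwise : ∀ k ∈ Finset.Ico a b, ∀ l ∈ Finset.range n \ Finset.Ico a b,
      g k l ^ 2 ≤ r ^ 2 / 8 * (u k ^ 2 * w l ^ 2 + w k ^ 2 * u l ^ 2) +
        C ^ 2 / 4 * (((k : ℝ) - l) ^ 2)⁻¹ := fun k hk l hl => by
    refine sq_le_of_near_or_far hp hr n.cast_nonneg (sub_ne_zero.2 ?_) (hg k l) (decay k l)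
      (near_or_far k hk l hl)
    intro h
    exact (Finset.mem_sdiff.1 hl).2 (Nat.cast_injective h ▸ hk)
  have restrict {x : ℕ → ℝ} (hx : ∑ k ∈ Finset.range n, x k ^ 2 ≤ 1) :
      ∑ k ∈ Finset.Ico a b, x k ^ 2 ≤ 1 ∧ ∑ k ∈ Finset.range n \ Finset.Ico a b, x k ^ 2 ≤ 1 := by
    have subset : Finset.Ico a b ⊆ Finset.range n := fun k hk =>
      Finset.mem_range.2 ((Finset.mem_Ico.1 hk).2.trans_le hbn)
    have nonneg {s : Finset ℕ} : 0 ≤ ∑ k ∈ s, x k ^ 2 := Finset.sum_nonneg fun _ _ => sq_nonneg _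
    rw [← Finset.sum_sdiff subset] at hx
    exact ⟨(le_add_of_nonneg_left nonneg).trans hx, (le_add_of_nonneg_right nonneg).trans hx⟩
  have product {x y : ℕ → ℝ} (hx : ∑ k ∈ Finset.range n, x k ^ 2 ≤ 1)
      (hy : ∑ k ∈ Finset.range n, y k ^ 2 ≤ 1) :
      ∑ k ∈ Finset.Ico a b, ∑ l ∈ Finset.range n \ Finset.Ico a b, x k ^ 2 * y l ^ 2 ≤ 1 := by
    rw [← Finset.sum_mul_sum]
    exact mul_le_one₀ (restrict hx).1 (Finset.sum_nonneg fun _ _ => sq_nonneg _) (restrict hy).2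
  have log_sum := sum_Ico_sdiff_inv_sq_sub_le hab hbn
  refine (Finset.sum_le_sum fun k hk => Finset.sum_le_sum (pointwise k hk)).trans ?_
  simp only [Finset.sum_add_distrib, ← Finset.mul_sum] at *
  nlinarith [product hu hw, product hw hu, sq_nonneg r, sq_nonneg C]

end BoundarySum

lemma weight_pos_iff {n k : ℕ} : 0 < ((n : ℝ) - 1) / 2 - k ↔ k < n / 2 := by
  have : k < n / 2 ↔ (2 * k + 1 : ℝ) < n := by
    rw [show k < n / 2 ↔ 2 * k + 1 < n by omega]
    norm_cast
  rw [this]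
  constructor <;> intro h <;> linarith

lemma exists_forall_weight_mem_Ioo_iff {n d : ℕ} {x : ℝ}
    (hx : (Set.Ioo 0 x ∩ spinSpectrum n).ncard = d) :
    ∃ c, c + d = n / 2 ∧
      ∀ k : ℕ, ((n : ℝ) - 1) / 2 - k ∈ Set.Ioo 0 x ↔ k ∈ Finset.Ico c (n / 2) := by
  have lt_mono {k l : ℕ} (hkl : k ≤ l) (h : ((n : ℝ) - 1) / 2 - k < x) :
      ((n : ℝ) - 1) / 2 - l < x := lt_of_le_of_lt (by gcongr) h
  have exists_lt : ∃ k : ℕ, ((n : ℝ) - 1) / 2 - k < x :=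
    (exists_nat_gt (((n : ℝ) - 1) / 2 - x)).imp fun k hk => by linarith
  classical
  have mem_iff (k : ℕ) : ((n : ℝ) - 1) / 2 - k ∈ Set.Ioo 0 x ↔
      k ∈ Finset.Ico (min (Nat.find exists_lt) (n / 2)) (n / 2) := by
    have : ((n : ℝ) - 1) / 2 - k < x ↔ Nat.find exists_lt ≤ k :=
      ⟨Nat.find_min' exists_lt, fun h => lt_mono h (Nat.find_spec exists_lt)⟩
    rw [Set.mem_Ioo, weight_pos_iff, this, Finset.mem_Ico]
    omega
  refine ⟨min (Nat.find exists_lt) (n / 2), ?_, mem_iff⟩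
  have image : Set.Ioo 0 x ∩ spinSpectrum n = (fun k : ℕ => ((n : ℝ) - 1) / 2 - k) ''
      Finset.Ico (min (Nat.find exists_lt) (n / 2)) (n / 2) := by
    ext y
    constructor
    · rintro ⟨hy, k, rfl⟩
      exact ⟨k, (mem_iff k).1 hy, rfl⟩
    · rintro ⟨k, hk, rfl⟩
      have := (Finset.mem_Ico.1 hk).2
      exact ⟨(mem_iff k).2 hk, ⟨k, by omega⟩, rfl⟩
  rw [image, Set.ncard_image_of_injective _ fun k l h => by simpa using h,
    Set.ncard_coe_finset, Nat.card_Ico] at hx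
  omega

namespace IsJacobiBasis

variable {n : ℕ} {J₁ J₃ : Module.End ℂ (EuclideanSpace ℂ (Fin n))}
  {e f : ℕ → EuclideanSpace ℂ (Fin n)}

lemma mul_sq_norm_inner_middle_le (he : IsJacobiBasis J₁ J₃ e) (hf : IsJacobiBasis J₃ J₁ f)
    (hJ : J₁.IsSymmetric) {q : ℕ} (hq : q ≤ n / 2) (hq' : n / 2 ≤ q + 1) {p : ℕ} (hp : 0 < p)
    (hpn : 4 * p ≤ n) {r : ℝ} (hr : n ≤ r * p) {k : ℕ} (hpk : p ≤ k) (hkp : k + p ≤ n) :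
    n * ‖⟪e k, f q⟫_ℂ‖ ^ 2 ≤ 8 * Real.exp (2 * r ^ 2) := by
  have weight_le : |((n : ℝ) - 1) / 2 - q| ≤ 1 := by
    have h₁ : (2 * q : ℝ) ≤ n := by exact_mod_cast (by omega : 2 * q ≤ n)
    have h₂ : (n : ℝ) ≤ 2 * q + 3 := by exact_mod_cast (by omega : n ≤ 2 * q + 3)
    rw [abs_le]
    constructor <;> linarith
  refine (he.mul_sq_norm_inner_le hJ weight_le (hf.weight q) hp hpn hr hpk hkp).trans ?_
  exact mul_le_of_le_one_right (by positivity)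
    (pow_le_one₀ (norm_nonneg _) (hf.norm_le_one q))

theorem sum_sq_norm_inner_boundary_le (he : IsJacobiBasis J₁ J₃ e) (hf : IsJacobiBasis J₃ J₁ f)
    (hJ₁ : J₁.IsSymmetric) (hJ₃ : J₃.IsSymmetric) {c p : ℕ} (hcn : c ≤ n / 2) (hp : 0 < p)
    (hpn : 4 * p ≤ n) {r : ℝ} (hr : n ≤ r * p) (hc : c = 0 ∨ 2 * p ≤ c) :
    ∑ k ∈ Finset.Ico c (n / 2), ∑ l ∈ Finset.range n \ Finset.Ico c (n / 2),
        ‖⟪e l, spectralProjection J₁ (Set.Ioi 0) (e k)⟫_ℂ‖ ^ 2 ≤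
      r ^ 2 / 4 + (8 * Real.exp (2 * r ^ 2)) ^ 2 * (1 + Real.log n) := by
  have hQ (k : ℕ) : spectralProjection J₁ (Set.Ioi 0) (f k) = if k < n / 2 then f k else 0 := by
    classical
    simp only [hf.spectralProjection_apply hJ₁, Set.mem_Ioi, weight_pos_iff]
  have mass (q : ℕ) : ∑ k ∈ Finset.range n, ‖⟪e k, f q⟫_ℂ‖ ^ 2 ≤ 1 := by
    rw [he.sum_sq_norm_inner]
    exact pow_le_one₀ (norm_nonneg _) (hf.norm_le_one q)
  refine sum_boundary_sq_le hcn (by omega) (by exact_mod_cast hp : (0 : ℝ) < p) hr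
    (fun _ _ => norm_nonneg _) (mass (n / 2 - 1)) (mass (n / 2)) (fun k l => ?_)
    fun k hk l hl => ?_
  · rw [abs_sub_comm, mul_comm ‖⟪e k, f (n / 2 - 1)⟫_ℂ‖, mul_comm ‖⟪e k, f (n / 2)⟫_ℂ‖,
      add_comm (_ * _)]
    exact he.abs_sub_mul_norm_inner_le hf hJ₃ hQ l k
  · rw [Finset.mem_sdiff, Finset.mem_range, Finset.mem_Ico] at hl
    rw [Finset.mem_Ico] at hk
    refine or_iff_not_imp_left.2 fun near => ?_
    rw [not_le, abs_lt] at near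
    have h₁ : k < l + p := by exact_mod_cast (by linarith [near.2] : (k : ℝ) < l + p)
    have h₂ : l < k + p := by exact_mod_cast (by linarith [near.1] : (l : ℝ) < k + p)
    have bulk (q : ℕ) (hq : q ≤ n / 2) (hq' : n / 2 ≤ q + 1) (i : ℕ) (hi : p ≤ i ∧ i + p ≤ n) :=
      he.mul_sq_norm_inner_middle_le hf hJ₁ hq hq' hp hpn hr hi.1 hi.2
    refine ⟨bulk _ ?_ ?_ k ?_, bulk _ ?_ ?_ k ?_, bulk _ ?_ ?_ l ?_, bulk _ ?_ ?_ l ?_⟩ <;> omega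

lemma exists_halfTurn (he : IsJacobiBasis J₁ J₃ e) (hJ : J₃.IsSymmetric) :
    ∃ U : Module.End ℂ (EuclideanSpace ℂ (Fin n)),
      U.IsSymmetric ∧ (∀ k, U (e k) = (-1 : ℂ) ^ k • e k) ∧ J₁ * U = -(U * J₁) := by
  classical
  set odd : Set ℝ := (fun k : ℕ => ((n : ℝ) - 1) / 2 - k) '' {k | Odd k}
  have mem_odd (k : ℕ) : ((n : ℝ) - 1) / 2 - k ∈ odd ↔ Odd k :=
    Function.Injective.mem_set_image (f := fun k : ℕ => ((n : ℝ) - 1) / 2 - k)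
      (s := {k | Odd k}) fun k l h => by simpa using h
  set U := 1 - (2 : ℂ) • spectralProjection J₃ odd
  have apply_U (k : ℕ) : U (e k) = (-1 : ℂ) ^ k • e k := by
    rw [LinearMap.sub_apply, LinearMap.smul_apply, Module.End.one_apply,
      he.spectralProjection_apply hJ, mem_odd]
    split_ifs with h
    · rw [h.neg_one_pow]
      module
    · rw [(Nat.not_odd_iff_even.1 h).neg_one_pow, smul_zero, sub_zero, one_smul]
  refine ⟨U, fun v w => ?_, apply_U, smul_right_injective _ (two_ne_zero' ℂ) ?_⟩
  · simp only [U, LinearMap.sub_apply, LinearMap.smul_apply, Module.End.one_apply, inner_sub_left,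
      inner_sub_right, inner_smul_left, inner_smul_right, map_ofNat,
      isSymmetricProjection_spectralProjection.isSymmetric v w]
  · refine he.linearMap_ext fun k _ => ?_
    simp only [LinearMap.smul_apply, LinearMap.neg_apply, Module.End.mul_apply, apply_U, map_smul,
      smul_neg, smul_comm (2 : ℂ) ((-1 : ℂ) ^ k)]
    rw [← map_smul U, he.two_smul_apply, map_add, map_smul, map_smul, apply_U, apply_U]
    rcases k with _ | k
    · simp [ladderCoeff_zero]
    · simp only [Nat.add_sub_cancel, pow_succ]
      module

lemma two_mul_sq_norm_spectralProjection_Ioi_add (he : IsJacobiBasis J₁ J₃ e)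
    (hJ₁ : J₁.IsSymmetric) (hJ₃ : J₃.IsSymmetric) (k : ℕ) :
    2 * ‖spectralProjection J₁ (Set.Ioi 0) (e k)‖ ^ 2 + ‖spectralProjection J₁ {0} (e k)‖ ^ 2 =
      ‖e k‖ ^ 2 := by
  have inner_apply (S : Set ℝ) := inner_apply_self_eq_sq_norm
    (isSymmetricProjection_spectralProjection (A := J₁) (S := S)) (e k)
  obtain ⟨U, U_symm, U_apply, anticomm⟩ := he.exists_halfTurn hJ₃
  have reflect : ⟪e k, spectralProjection J₁ (Set.Iio 0) (e k)⟫_ℂ =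
      ⟪e k, spectralProjection J₁ (Set.Ioi 0) (e k)⟫_ℂ := by
    have h := congrArg (⟪e k, ·⟫_ℂ) (LinearMap.congr_fun
      (spectralProjection_neg_mul_of_anticomm (S := Set.Ioi 0) hJ₁ anticomm) (e k))
    simp only [Module.End.mul_apply, ← U_symm (e k), U_apply, map_smul, inner_smul_left,
      inner_smul_right, Set.neg_Ioi, neg_zero, map_pow, map_neg, map_one] at h
    exact mul_left_cancel₀ (pow_ne_zero k (neg_ne_zero.2 one_ne_zero)) h
  have resolution := congrArg (⟪e k, ·⟫_ℂ)
    (LinearMap.congr_fun (spectralProjection_Ioi_add_Iio_add_singleton hJ₁ 0) (e k))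
  simp only [LinearMap.add_apply, inner_add_right, reflect, inner_apply, Module.End.one_apply,
    inner_self_eq_norm_sq_to_K, RCLike.ofReal_eq_complex_ofReal] at resolution
  rw [two_mul]
  exact_mod_cast resolution

lemma sum_sq_norm_spectralProjection_singleton_le_one (hf : IsJacobiBasis J₃ J₁ f)
    (hJ : J₁.IsSymmetric) {ι : Type*} [Fintype ι]
    (b : OrthonormalBasis ι ℂ (EuclideanSpace ℂ (Fin n))) (x : ℝ) :
    ∑ k, ‖spectralProjection J₁ {x} (b k)‖ ^ 2 ≤ 1 := by
  classical
  rw [← re_trace_eq_sum_sq_norm isSymmetricProjection_spectralProjection b,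
    re_trace_eq_sum_sq_norm isSymmetricProjection_spectralProjection hf.orthonormalBasis]
  have term (k : Fin n) : ‖spectralProjection J₁ {x} (hf.orthonormalBasis k)‖ ^ 2 =
      if ((n : ℝ) - 1) / 2 - (k : ℕ) = x then 1 else 0 := by
    simp only [hf.orthonormalBasis_apply, hf.spectralProjection_apply hJ, Set.mem_singleton_iff]
    split_ifs
    · rw [hf.orthonormal.1 k, one_pow]
    · simp
  simp only [term, Finset.sum_boole]
  refine Nat.cast_le_one.2 (Finset.card_le_one.2 fun k hk l hl => ?_)
  rw [Finset.mem_filter] at hk hl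
  exact Fin.ext (Nat.cast_injective (R := ℝ) (by linarith [hk.2, hl.2]))

end IsJacobiBasis

/-- The operator `R_n = P_{3,α,n} P_{1,n} P_{3,α,n}` on the range of `P_{3,α,n}`, with `x` in the
role of `α_n`. -/
noncomputable def weightCompression {n : ℕ} (J₁ J₃ : Module.End ℂ (EuclideanSpace ℂ (Fin n)))
    (x : ℝ) : Module.End ℂ (LinearMap.range (spectralProjection J₃ (Set.Ioo 0 x))) :=
  compression (spectralProjection J₃ (Set.Ioo 0 x)) (spectralProjection J₁ (Set.Ioi 0))

section WeightCompression

variable {n d : ℕ} {J₁ J₂ J₃ : Module.End ℂ (EuclideanSpace ℂ (Fin n))} {x t : ℝ}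

lemma isPositive_weightCompression (J₁ J₃ : Module.End ℂ (EuclideanSpace ℂ (Fin n))) (x : ℝ) :
    LinearMap.IsPositive (𝕜 := ℂ) (E := LinearMap.range (spectralProjection J₃ (Set.Ioo 0 x)))
      (weightCompression J₁ J₃ x) :=
  isPositive_compression isSymmetricProjection_spectralProjection
    isSymmetricProjection_spectralProjection.isPositive

lemma isPositive_one_sub_weightCompression (J₁ J₃ : Module.End ℂ (EuclideanSpace ℂ (Fin n)))
    (x : ℝ) :
    LinearMap.IsPositive (𝕜 := ℂ) (E := LinearMap.range (spectralProjection J₃ (Set.Ioo 0 x)))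
      (1 - weightCompression J₁ J₃ x) := by
  have proj := isSymmetricProjection_spectralProjection (A := J₁) (S := Set.Ioi 0)
  rw [weightCompression,
    one_sub_compression isSymmetricProjection_spectralProjection.isIdempotentElem]
  exact isPositive_compression isSymmetricProjection_spectralProjection
    (LinearMap.IsSymmetricProjection.isPositive
      ⟨proj.isIdempotentElem.one_sub, LinearMap.IsSymmetric.one.sub proj.isSymmetric⟩)

lemma sum_attachFin {s : Finset ℕ} (hs : ∀ k ∈ s, k < n) (F : ℕ → ℝ) :
    ∑ k ∈ s.attachFin hs, F k = ∑ k ∈ s, F k := by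
  conv_rhs => rw [← Finset.map_valEmbedding_attachFin hs, Finset.sum_map]
  rfl

lemma sum_compl_attachFin {s : Finset ℕ} (hs : ∀ k ∈ s, k < n) (F : ℕ → ℝ) :
    ∑ k ∈ (s.attachFin hs)ᶜ, F k = ∑ k ∈ Finset.range n \ s, F k := by
  have compl_eq : (s.attachFin hs)ᶜ = (Finset.range n \ s).attachFin
      fun k hk => Finset.mem_range.1 (Finset.mem_sdiff.1 hk).1 := by
    ext k
    simp only [Finset.mem_compl, Finset.mem_attachFin, Finset.mem_sdiff, Finset.mem_range, k.2,
      true_and]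
  rw [compl_eq, sum_attachFin]

lemma exists_spectralProjection_Ioo_apply (hJ : IsSpinTriple J₁ J₂ J₃)
    (hx : (Set.Ioo 0 x ∩ spinSpectrum n).ncard = d) :
    ∃ (c : ℕ) (hc : ∀ k ∈ Finset.Ico c (n / 2), k < n), c + d = n / 2 ∧
      ∀ {e : ℕ → EuclideanSpace ℂ (Fin n)} (he : IsJacobiBasis J₁ J₃ e) (k : Fin n),
        spectralProjection J₃ (Set.Ioo 0 x) (he.orthonormalBasis k) =
          if k ∈ (Finset.Ico c (n / 2)).attachFin hc then he.orthonormalBasis k else 0 := by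
  classical
  obtain ⟨c, hcd, mem_iff⟩ := exists_forall_weight_mem_Ioo_iff hx
  refine ⟨c, fun k hk => by rw [Finset.mem_Ico] at hk; omega, hcd, fun he k => ?_⟩
  simp only [he.orthonormalBasis_apply, he.spectralProjection_apply hJ.isSymmetric_three, mem_iff,
    Finset.mem_attachFin]

lemma finrank_range_spectralProjection_Ioo (hJ : IsSpinTriple J₁ J₂ J₃) (hn : 1 < n)
    (hx : (Set.Ioo 0 x ∩ spinSpectrum n).ncard = d) :
    Module.finrank ℂ (LinearMap.range (spectralProjection J₃ (Set.Ioo 0 x))) = d := by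
  obtain ⟨e, he⟩ := hJ.exists_isJacobiBasis hn
  obtain ⟨c, hc, hcd, apply_e⟩ := exists_spectralProjection_Ioo_apply hJ hx
  rw [finrank_range_eq_card isSymmetricProjection_spectralProjection.isIdempotentElem (apply_e he),
    Finset.card_attachFin, Nat.card_Ico]
  omega

theorem abs_sub_two_mul_trace_weightCompression_le (hJ : IsSpinTriple J₁ J₂ J₃) (hn : 1 < n)
    (hx : (Set.Ioo 0 x ∩ spinSpectrum n).ncard = d) :
    |d - 2 * (LinearMap.trace ℂ _ (weightCompression J₁ J₃ x)).re| ≤ 1 := by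
  obtain ⟨e, he⟩ := hJ.exists_isJacobiBasis hn
  obtain ⟨f, hf⟩ := hJ.quarterTurn.exists_isJacobiBasis hn
  obtain ⟨c, hc, -, apply_e⟩ := exists_spectralProjection_Ioo_apply hJ hx
  have proj := isSymmetricProjection_spectralProjection (A := J₃) (S := Set.Ioo 0 x)
  set A := (Finset.Ico c (n / 2)).attachFin hc
  have card_A : (A.card : ℝ) = d := by
    rw [← finrank_range_eq_card proj.isIdempotentElem (apply_e he),
      finrank_range_spectralProjection_Ioo hJ hn hx]
  have defect_eq : d - 2 * (LinearMap.trace ℂ _ (weightCompression J₁ J₃ x)).re =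
      ∑ k ∈ A, ‖spectralProjection J₁ {0} (he.orthonormalBasis k)‖ ^ 2 := by
    rw [weightCompression, re_trace_compression proj.isIdempotentElem
      isSymmetricProjection_spectralProjection (apply_e he), ← card_A, Finset.mul_sum,
      Finset.cast_card, ← Finset.sum_sub_distrib]
    refine Finset.sum_congr rfl fun k _ => ?_
    have := he.two_mul_sq_norm_spectralProjection_Ioi_add hJ.isSymmetric_one
      hJ.isSymmetric_three k
    rw [← he.orthonormalBasis_apply, OrthonormalBasis.norm_eq_one] at this
    linarith
  rw [defect_eq, abs_of_nonneg (Finset.sum_nonneg fun _ _ => sq_nonneg _)]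
  exact (Finset.sum_le_univ_sum_of_nonneg fun _ => sq_nonneg _).trans
    (hf.sum_sq_norm_spectralProjection_singleton_le_one hJ.isSymmetric_one he.orthonormalBasis 0)

theorem trace_weightCompression_mul_one_sub_le (hJ : IsSpinTriple J₁ J₂ J₃)
    (hx : (Set.Ioo 0 x ∩ spinSpectrum n).ncard = d) {p : ℕ} (hp : 0 < p) (hpn : 4 * p ≤ n) {r : ℝ}
    (hr : n ≤ r * p) (hd : d = n / 2 ∨ d + 2 * p ≤ n / 2) :
    (LinearMap.trace ℂ _ (weightCompression J₁ J₃ x * (1 - weightCompression J₁ J₃ x))).re ≤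
      r ^ 2 / 4 + (8 * Real.exp (2 * r ^ 2)) ^ 2 * (1 + Real.log n) := by
  obtain ⟨e, he⟩ := hJ.exists_isJacobiBasis (by omega)
  obtain ⟨f, hf⟩ := hJ.quarterTurn.exists_isJacobiBasis (by omega)
  obtain ⟨c, hc, hcd, apply_e⟩ := exists_spectralProjection_Ioo_apply hJ hx
  set g : ℕ → ℕ → ℝ := fun k l => ‖⟪e l, spectralProjection J₁ (Set.Ioi 0) (e k)⟫_ℂ‖ ^ 2
  have sum_compl (k : ℕ) : ∑ l ∈ ((Finset.Ico c (n / 2)).attachFin hc)ᶜ, g k l =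
      ∑ l ∈ Finset.range n \ Finset.Ico c (n / 2), g k l := sum_compl_attachFin hc (g k)
  rw [weightCompression, re_trace_compression_mul_one_sub isSymmetricProjection_spectralProjection
    isSymmetricProjection_spectralProjection (apply_e he)]
  simp only [he.orthonormalBasis_apply]
  calc ∑ k ∈ (Finset.Ico c (n / 2)).attachFin hc,
        ∑ l ∈ ((Finset.Ico c (n / 2)).attachFin hc)ᶜ, g k l
      = ∑ k ∈ Finset.Ico c (n / 2), ∑ l ∈ Finset.range n \ Finset.Ico c (n / 2), g k l := by
        simp only [sum_compl]
        exact sum_attachFin hc fun k => ∑ l ∈ Finset.range n \ Finset.Ico c (n / 2), g k l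
    _ ≤ _ := he.sum_sq_norm_inner_boundary_le hf hJ.isSymmetric_one hJ.isSymmetric_three
        (by omega) hp hpn hr (by omega)

end WeightCompression

section Asymptotics

lemma exists_eventually_floor_margin {α : ℝ} (hα₀ : 0 ≤ α) (hα₁ : α ≤ 1 / 2) :
    ∃ r : ℝ, ∀ᶠ n : ℕ in atTop, ∃ p : ℕ, 0 < p ∧ 4 * p ≤ n ∧ n ≤ r * p ∧
      (⌊α * (n : ℝ)⌋₊ = n / 2 ∨ ⌊α * (n : ℝ)⌋₊ + 2 * p ≤ n / 2) := by
  obtain ⟨δ, hδ, hδ₁, hδα⟩ : ∃ δ : ℝ, 0 < δ ∧ δ ≤ 1 / 8 ∧ (α = 1 / 2 ∨ 4 * δ = 1 / 2 - α) := by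
    rcases hα₁.eq_or_lt with h | h
    · exact ⟨1 / 8, by norm_num, le_rfl, Or.inl h⟩
    · exact ⟨(1 / 2 - α) / 4, by linarith, by linarith, Or.inr (by ring)⟩
  refine ⟨δ⁻¹, ?_⟩
  filter_upwards [tendsto_natCast_atTop_atTop.eventually_ge_atTop (3 / δ),
    eventually_ge_atTop 8] with n hn hn₈
  have hn₈' : (8 : ℝ) ≤ n := by exact_mod_cast hn₈
  rw [div_le_iff₀ hδ] at hn
  have ceil_lt := Nat.ceil_lt_add_one (by positivity : 0 ≤ δ * (n : ℝ))
  refine ⟨⌈δ * (n : ℝ)⌉₊, Nat.ceil_pos.2 (by positivity), ?_, ?_, ?_⟩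
  · exact_mod_cast (by nlinarith : (4 * ⌈δ * (n : ℝ)⌉₊ : ℝ) ≤ n)
  · rw [← div_eq_inv_mul, le_div_iff₀ hδ, mul_comm]
    exact Nat.le_ceil _
  · refine hδα.imp (fun half => ?_) fun margin => ?_
    · rw [half, one_div_mul_eq_div, Nat.floor_div_ofNat, Nat.floor_natCast]
    · have floor_le := Nat.floor_le (by positivity : 0 ≤ α * (n : ℝ))
      have : 2 * ⌊α * (n : ℝ)⌋₊ + 4 * ⌈δ * (n : ℝ)⌉₊ + 1 ≤ n := by
        exact_mod_cast (by nlinarith :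
          (2 * ⌊α * (n : ℝ)⌋₊ + 4 * ⌈δ * (n : ℝ)⌉₊ + 1 : ℝ) ≤ n)
      omega

theorem exists_trace_weightCompression_mul_one_sub_le_log {α : ℝ} (hα₀ : 0 ≤ α)
    (hα₁ : α ≤ 1 / 2) :
    ∃ K : ℝ, ∀ᶠ n : ℕ in atTop, ∀ J₁ J₂ J₃ : Module.End ℂ (EuclideanSpace ℂ (Fin n)),
      IsSpinTriple J₁ J₂ J₃ → ∀ x, (Set.Ioo 0 x ∩ spinSpectrum n).ncard = ⌊α * (n : ℝ)⌋₊ →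
        (LinearMap.trace ℂ _ (weightCompression J₁ J₃ x * (1 - weightCompression J₁ J₃ x))).re ≤
          K * Real.log n := by
  obtain ⟨r, margin⟩ := exists_eventually_floor_margin hα₀ hα₁
  refine ⟨r ^ 2 / 4 + 2 * (8 * Real.exp (2 * r ^ 2)) ^ 2, ?_⟩
  filter_upwards [margin,
    (Real.tendsto_log_atTop.comp tendsto_natCast_atTop_atTop).eventually_ge_atTop 1]
    with n ⟨p, hp, hpn, hr, hd⟩ one_le_log J₁ J₂ J₃ hJ x hx
  rw [Function.comp_apply] at one_le_log
  refine (trace_weightCompression_mul_one_sub_le hJ hx hp hpn hr hd).trans ?_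
  nlinarith [sq_nonneg r, sq_nonneg (8 * Real.exp (2 * r ^ 2))]

theorem exists_eigenvalueCount_weightCompression_le_log {α t : ℝ} (hα₀ : 0 ≤ α)
    (hα₁ : α ≤ 1 / 2) (ht₀ : 0 < t) (ht₁ : t ≤ 1 / 2) :
    ∃ K : ℝ, ∀ᶠ n : ℕ in atTop, ∀ J₁ J₂ J₃ : Module.End ℂ (EuclideanSpace ℂ (Fin n)),
      IsSpinTriple J₁ J₂ J₃ → ∀ x, (Set.Ioo 0 x ∩ spinSpectrum n).ncard = ⌊α * (n : ℝ)⌋₊ →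
        |eigenvalueCount (weightCompression J₁ J₃ x) 0 t - α * n / 2| ≤ K * Real.log n ∧
        |eigenvalueCount (weightCompression J₁ J₃ x) (1 - t) 1 - α * n / 2| ≤ K * Real.log n ∧
        eigenvalueCount (weightCompression J₁ J₃ x) t (1 - t) ≤ K * Real.log n := by
  obtain ⟨K, defect_le⟩ := exists_trace_weightCompression_mul_one_sub_le_log hα₀ hα₁
  refine ⟨1 + 2 * |K| / t, ?_⟩
  filter_upwards [defect_le, eventually_gt_atTop 1,
    (Real.tendsto_log_atTop.comp tendsto_natCast_atTop_atTop).eventually_ge_atTop 1]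
    with n defect_le hn one_le_log J₁ J₂ J₃ hJ x hx
  rw [Function.comp_apply] at one_le_log
  have pos := isPositive_weightCompression J₁ J₃ x
  have pos' := isPositive_one_sub_weightCompression J₁ J₃ x
  have top := abs_eigenvalueCount_top_sub_trace_le pos pos' ht₀ ht₁
  have bottom := abs_eigenvalueCount_bottom_sub_trace_le pos pos' ht₀ ht₁
  have middle := eigenvalueCount_middle_le_trace pos pos' ht₀ ht₁
  have half := abs_sub_two_mul_trace_weightCompression_le hJ hn hx
  have floor_le := Nat.floor_le (by positivity : 0 ≤ α * (n : ℝ))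
  have lt_floor := Nat.lt_floor_add_one (α * (n : ℝ))
  have error_le : (LinearMap.trace ℂ _ (weightCompression J₁ J₃ x *
      (1 - weightCompression J₁ J₃ x))).re / t ≤ |K| / t * Real.log n := by
    rw [div_mul_eq_mul_div]
    gcongr
    exact (defect_le J₁ J₂ J₃ hJ x hx).trans (by gcongr; exact le_abs_self K)
  have error_nonneg : 0 ≤ |K| / t * Real.log n := by positivity
  rw [finrank_range_spectralProjection_Ioo hJ hn hx] at bottom
  rw [mul_div_assoc] at middle
  rw [abs_le] at top bottom half
  rw [show (1 + 2 * |K| / t) * Real.log n = Real.log n + 2 * (|K| / t * Real.log n) by ring,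
    abs_le, abs_le]
  refine ⟨⟨?_, ?_⟩, ⟨?_, ?_⟩, ?_⟩ <;> linarith

lemma tendsto_one_div_mul_of_sub_isBigO_log {α L : ℝ} (hα : α ≠ 0) {f : ℕ → ℝ}
    (hf : (fun n : ℕ => f n - α * n * L) =O[atTop] fun n : ℕ => Real.log n) :
    Tendsto (fun n : ℕ => 1 / (α * (n : ℝ)) * f n) atTop (𝓝 L) := by
  have log_isLittleO : (fun n : ℕ => Real.log n) =o[atTop] fun n : ℕ => (n : ℝ) :=
    Real.isLittleO_log_id_atTop.comp_tendsto tendsto_natCast_atTop_atTop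
  have remainder : Tendsto (fun n : ℕ => α⁻¹ * ((f n - α * n * L) / n) + L) atTop (𝓝 L) := by
    simpa using ((hf.trans_isLittleO log_isLittleO).tendsto_div_nhds_zero.const_mul α⁻¹).add_const L
  refine remainder.congr' ?_
  filter_upwards [eventually_ne_atTop 0] with n hn
  field_simp
  ring

end Asymptotics

theorem mainTheorem3 (α : ℝ) (hα₀ : 0 < α) (hα₁ : α ≤ 1 / 2)
    (J₁ J₂ J₃ : ∀ n : ℕ, Module.End ℂ (EuclideanSpace ℂ (Fin n)))
    (hJ : ∀ n : ℕ, 0 < n → IsSpinTriple (J₁ n) (J₂ n) (J₃ n))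
    (a : ℕ → ℝ)
    (ha : ∀ n : ℕ, 0 < n → (Set.Ioo 0 (a n) ∩ spinSpectrum n).ncard = ⌊α * (n : ℝ)⌋₊)
    (N : ℕ → ℝ → ℝ → ℕ)
    (hN : ∀ n s t, N n s t = eigenvalueCount
      (compression (spectralProjection (J₃ n) (Set.Ioo 0 (a n)))
        (spectralProjection (J₁ n) (Set.Ioi 0))) s t)
    (t : ℝ) (ht₀ : 0 < t) (ht₁ : t < 1 / 2) :
    Tendsto (fun n : ℕ => 1 / (α * (n : ℝ)) * (N n 0 t : ℝ)) atTop (𝓝 (1 / 2)) ∧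
    Tendsto (fun n : ℕ => 1 / (α * (n : ℝ)) * (N n (1 - t) 1 : ℝ)) atTop (𝓝 (1 / 2)) ∧
    (fun n : ℕ => (N n t (1 - t) : ℝ)) =O[atTop] (fun n : ℕ => Real.log (n : ℝ)) := by
  obtain ⟨K, estimates⟩ :=
    exists_eigenvalueCount_weightCompression_le_log hα₀.le hα₁ ht₀ ht₁.le
  have counts : ∀ᶠ n : ℕ in atTop,
      |N n 0 t - α * n / 2| ≤ K * Real.log n ∧ |N n (1 - t) 1 - α * n / 2| ≤ K * Real.log n ∧
        N n t (1 - t) ≤ K * Real.log n := by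
    filter_upwards [estimates, eventually_gt_atTop 0] with n estimates hn
    simp only [hN]
    exact estimates _ _ _ (hJ n hn) _ (ha n hn)
  have isBigO_log {g : ℕ → ℝ} (hg : ∀ᶠ n : ℕ in atTop, |g n| ≤ K * Real.log n) :
      g =O[atTop] fun n : ℕ => Real.log n := by
    refine IsBigO.of_bound K (hg.mono fun n h => ?_)
    rwa [Real.norm_eq_abs, Real.norm_of_nonneg (Real.log_natCast_nonneg n)]
  refine ⟨tendsto_one_div_mul_of_sub_isBigO_log hα₀.ne' (isBigO_log ?_),
    tendsto_one_div_mul_of_sub_isBigO_log hα₀.ne' (isBigO_log ?_), isBigO_log ?_⟩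
  · exact counts.mono fun n h => by simpa only [mul_one_div] using h.1
  · exact counts.mono fun n h => by simpa only [mul_one_div] using h.2.1
  · exact counts.mono fun n h => by simpa only [Nat.abs_cast] using h.2.2
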